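/- For $\alpha\in\mathbb{C}$ and $n\ge 3$ let $L_{\alpha,n}$ be the $n\times n$ matrix with diagonal $(1+\overline{\alpha},2,2,\ldots,2,1+\alpha)$, entries $-1$ on the first sub- and superdiagonal, entry $-\overline{\alpha}$ at position $(1,n)$, entry $-\alpha$ at position $(n,1)$, and zeros elsewhere. Its eigenvalues are real (they coincide with those of the real symmetric matrix $L_{\operatorname{Re}(\alpha),n}$); write them, with multiplicities, as $\lambda_{\alpha,n,1}\le\lambda_{\alpha,n,2}\le\cdots\le\lambda_{\alpha,n,n}$. Let $\operatorname{Re}(\alpha)<0$ and put $$\varkappa_\alpha=\frac{\operatorname{Re}(\alpha)-1}{\operatorname{Re}(\alpha)},\qquad N_\alpha=\max\{3,\lfloor\varkappa_\alpha\rfloor+1\},\qquad \omega_\alpha=\log(1-2\operatorname{Re}(\alpha)),\qquad d_{n,j}=\frac{(j-1)\pi}{n},$$ $$g(x)=4\sin^2\frac{x}{2},\qquad g_-(x)=2-2\cosh(x),\qquad \eta_\alpha(x)=2\arctan\left(\varkappa_\alpha\tan\frac{x}{2}\right)-\pi\quad(0\le x<\pi),\qquad \eta_\alpha(\pi)=0,$$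 $$\nu_\alpha(x)=\frac{1-\operatorname{Re}(\alpha)}{2}g(x)-\frac{\operatorname{Re}(\alpha)}{2}g(\eta_\alpha(x))+\frac{\operatorname{Re}(\alpha)-|\alpha|^2}{2}g(x-\eta_\alpha(x))+2|\alpha|^2,\qquad \mu_\alpha=\frac{|\alpha|}{2\sqrt{2(\operatorname{Re}(\alpha)^2-\operatorname{Re}(\alpha))}}.$$ For $n\ge N_\alpha$ one has $\lambda_{\alpha,n,1}<0$ and $\lambda_{\alpha,n,j}\in[0,4]$ for $3\le j\le n$. Let $z_{\alpha,n,j}\in[0,\pi]$ be the solution of $g(z_{\alpha,n,j})=\lambda_{\alpha,n,j}$ for $3\le j\le n$, let $s_{\alpha,n}\in[0,\infty)$ be the solution of $g_-(s_{\alpha,n})=\lambda_{\alpha,n,1}$, and let $v_{\alpha,n,j}\in\mathbb{C}^n$ ($3\le j\le n$) and $v_{\alpha,n,1}\in\mathbb{C}^n$ be the vectors with the components, for $1\le k\le n$, $$v_{\alpha,n,j,k}=\sin(kz_{\alpha,n,j})-(1-\overline{\alpha})\sin((k-1)z_{\alpha,n,j})+\overline{\alpha}\sin((n-k)z_{\alpha,n,j}),$$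 $$v_{\alpha,n,1,k}=\sinh(ks_{\alpha,n})-(1-\overline{\alpha})\sinh((k-1)s_{\alpha,n})+\overline{\alpha}\sinh((n-k)s_{\alpha,n}),$$ which are eigenvectors of $L_{\alpha,n}$ for $\lambda_{\alpha,n,j}$ and $\lambda_{\alpha,n,1}$, respectively. **Theorem (norms of eigenvectors for $\operatorname{Re}(\alpha)<0$).** Let $\alpha\in\mathbb{C}$ with $\operatorname{Re}(\alpha)<0$. 1. For every $n\ge N_\alpha$ and every odd $j$ with $3\le j\le n$, $$\|v_{\alpha,n,j}\|_2=|1-\alpha|\sqrt{\frac{n}{2}\lambda_{\alpha,n,j}}.$$ 2. There is a constant $C>0$, depending only on $\alpha$, such that for every $n\ge N_\alpha$ and every even $j$ with $4\le j\le n$, $$\left|\,\|v_{\alpha,n,j}\|_2-\sqrt{\nu_\alpha(d_{n,j})\,n}\,\right|\le\frac{C}{\sqrt{n}}.$$ 3. There is a constant $C>0$, depending only on $\alpha$, such that for every $n\ge N_\alpha$, $$\left|\,\|v_{\alpha,n,1}\|_2-\mu_\alpha e^{n\omega_\alpha}\right|\le Cn\qquad\text{and}\qquad\left|\,\|v_{\alpha,n,1}\|_2-\mu_\alpha(1-2\operatorname{Re}(\alpha))^n\right|\le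 Cn.$$ -/

import Mathlib

open Real

namespace WeightedCycle

noncomputable section

/-- The `n × n` complex laplacian matrix `L_{α,n}` (meant for `n ≥ 3`). The vertices `1, …, n` are
numbered `0, …, n - 1` here. -/
def L (α : ℂ) (n : ℕ) : Matrix (Fin n) (Fin n) ℂ :=
  Matrix.of fun i k =>
    if i = k then
      if i.val = 0 then 1 + (starRingEnd ℂ) α
      else if i.val + 1 = n then 1 + α
      else 2
    else if i.val + 1 = k.val ∨ k.val + 1 = i.val then -1
    else if i.val = 0 ∧ k.val + 1 = n then -(starRingEnd ℂ) α
    else if i.val + 1 = n ∧ k.val = 0 then -α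
    else 0

/-- `λ_{α,n,j}` for `1 ≤ j ≤ n`: the `j`-th smallest eigenvalue of `L_{α,n}`, counted with
algebraic multiplicity. The eigenvalues are those of the real symmetric matrix `L_{Re α,n}`, so
they are real numbers, and taking real parts only turns elements of `ℂ` into elements of `ℝ`. -/
def eigval (α : ℂ) (n j : ℕ) : ℝ :=
  (((L α n).charpoly.roots.map Complex.re).sort (· ≤ ·)).getD (j - 1) 0

/-- `g(x) = 4 sin²(x/2)`. -/
def g (x : ℝ) : ℝ := 4 * sin (x / 2) ^ 2

/-- `g₋(x) = 2 - 2 cosh x`. -/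
def gMinus (x : ℝ) : ℝ := 2 - 2 * cosh x

/-- `ϰ_α = (Re α - 1) / Re α`. -/
def kappa (α : ℂ) : ℝ := (α.re - 1) / α.re

/-- `N_α = max {3, ⌊ϰ_α⌋ + 1}`. -/
def N (α : ℂ) : ℕ := max 3 (⌊kappa α⌋₊ + 1)

/-- `d_{n,j} = (j - 1) π / n`. -/
def d (n j : ℕ) : ℝ := ((j : ℝ) - 1) * π / n

/-- `ω_α = log (1 - 2 Re α)`. -/
def omega (α : ℂ) : ℝ := log (1 - 2 * α.re)

/-- `z_{α,n,j}`: the preimage of `λ_{α,n,j}` under the bijection `g : [0, π] → [0, 4]`. -/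
def z (α : ℂ) (n j : ℕ) : ℝ := Function.invFunOn g (Set.Icc 0 π) (eigval α n j)

/-- `s_{α,n}`: the preimage of `λ_{α,n,1}` under the bijection `g₋ : [0, ∞) → (-∞, 0]`. -/
def s (α : ℂ) (n : ℕ) : ℝ := Function.invFunOn gMinus (Set.Ici 0) (eigval α n 1)

/-- `η_α(x) = 2 arctan (ϰ_α tan (x/2)) - π` on `[0, π]`, with the limit value `0` at `x = π`. -/
def eta (α : ℂ) (x : ℝ) : ℝ :=
  if x = π then 0 else 2 * arctan (kappa α * tan (x / 2)) - π

/-- The function `ν_α`. -/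
def nu (α : ℂ) (x : ℝ) : ℝ :=
  (1 - α.re) / 2 * g x - α.re / 2 * g (eta α x)
    + (α.re - ‖α‖ ^ 2) / 2 * g (x - eta α x) + 2 * ‖α‖ ^ 2

/-- The number `μ_α`. -/
def mu (α : ℂ) : ℝ := ‖α‖ / (2 * √(2 * (α.re ^ 2 - α.re)))

/-- The vector `v_{α,n,j}` for `3 ≤ j ≤ n`; its component number `k` (`1 ≤ k ≤ n`) has the index
`k - 1`. -/
def innerVec (α : ℂ) (n j : ℕ) : EuclideanSpace ℂ (Fin n) :=
  WithLp.toLp 2 fun i =>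
    let k : ℝ := (i.val : ℝ) + 1
    (sin (k * z α n j) : ℂ)
      - (1 - (starRingEnd ℂ) α) * (sin ((k - 1) * z α n j) : ℂ)
      + (starRingEnd ℂ) α * (sin (((n : ℝ) - k) * z α n j) : ℂ)

/-- The vector `v_{α,n,1}`; its component number `k` (`1 ≤ k ≤ n`) has the index `k - 1`. -/
def firstVec (α : ℂ) (n : ℕ) : EuclideanSpace ℂ (Fin n) :=
  WithLp.toLp 2 fun i =>
    let k : ℝ := (i.val : ℝ) + 1
    (sinh (k * s α n) : ℂ)
      - (1 - (starRingEnd ℂ) α) * (sinh ((k - 1) * s α n) : ℂ)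
      + (starRingEnd ℂ) α * (sinh (((n : ℝ) - k) * s α n) : ℂ)

end

end WeightedCycle

/-! An eigenvector extends to a sequence on `0, …, n + 1` that solves a three-term recurrence with
two boundary conditions. Split the solutions by parity under the reflection `k ↦ n + 1 - k`. Even
solutions with sin(nx/2) = 0 satisfy both conditions for every α; a mixture of an even and an odd
solution does so when tan(nx/2) = ϰ tan(x/2), or tanh(nx/2) = ϰ tanh(x/2) for negative eigenvalues.
The intermediate value theorem gives enough interlacing solutions to produce n distinct roots of a
polynomial of degree n, so these are all the eigenvalues, in order; uniqueness in each interval is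
never needed (`eigval_eq_eigSeq`).

Written about the centre, the components of the vectors are combinations of cos t and sin t (or cosh
t and sinh t) with t in a symmetric arithmetic progression, so the squared norms have closed forms.
For odd j, sin(nx/2) = 0 leaves the exact formula. Otherwise the eigenvalue equation and 1 + Re(α)(ϰ
- 1) = 0 kill one coefficient.

For even j the squared norm is ν(z)n up to ϰν(z). Since √ν is the norm of a smooth vector function,
it is Lipschitz even near the zero of ν at 0, and z can be replaced by d at distance at most π/n.

For j = 1 the squared norm is a quadratic polynomial in cosh²(ns/2), with coefficients depending on
n and s, and s is exponentially close to ω by an exact identity (`exp_mul_sub_exp`). -/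

namespace WeightedCycle

/-! ### Roots of the characteristic polynomial from the recurrence. -/

/-- A nonzero solution of the three-term recurrence with the boundary conditions of `L α n`
gives an eigenvalue. -/
theorem isRoot_charpoly_of_recurrence {α : ℂ} {n : ℕ} (hn : 3 ≤ n) {lam : ℂ} {f : ℕ → ℂ}
    (hrec : ∀ k < n, f k + f (k + 2) = (2 - lam) * f (k + 1))
    (h0 : f 0 = (1 - (starRingEnd ℂ) α) * f 1 + (starRingEnd ℂ) α * f n)
    (h1 : f (n + 1) = (1 - α) * f n + α * f 1)
    (hne : ∃ k < n, f (k + 1) ≠ 0) : (L α n).charpoly.IsRoot lam := by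
  rw [Polynomial.IsRoot.def, Matrix.eval_charpoly]
  apply Matrix.exists_mulVec_eq_zero_iff.mp
  refine ⟨fun i => f (i.val + 1), ?_, ?_⟩
  · obtain ⟨k, hk, hf⟩ := hne
    exact fun h => hf (congrFun h ⟨k, hk⟩)
  · have key : ∀ i : Fin n, ∑ k : Fin n, L α n i k * f (k.val + 1) = lam * f (i.val + 1) := by
      intro i
      have hi := i.isLt
      have hr := hrec i.val hi
      rcases Nat.eq_zero_or_pos i.val with h | h
      · have e : ∀ k : Fin n, L α n i k * f (k.val + 1)
            = (if k = ⟨0, by omega⟩ then (1 + (starRingEnd ℂ) α) * f 1 else 0)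
              + (if k = ⟨1, by omega⟩ then -f 2 else 0)
              + (if k = ⟨n - 1, by omega⟩ then -(starRingEnd ℂ) α * f n else 0) := by
          intro k
          have hk := k.isLt
          simp only [L, Matrix.of_apply, Fin.ext_iff, h]
          rcases Nat.lt_or_ge k.val 1 with h2 | h2
          · have : k.val = 0 := by omega
            have h3 : ¬ (0 = n - 1) := by omega
            simp [this, h3]
          · rcases Nat.lt_or_ge k.val 2 with h4 | h4
            · have : k.val = 1 := by omega
              have h3 : ¬ (1 = n - 1) := by omega
              simp [this, h3]
            · have a1 : ¬ (0 = k.val) := by omega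
              have a2 : ¬ (k.val = 0) := by omega
              have a3 : ¬ (k.val = 1) := by omega
              have a4 : ¬ (1 = k.val) := by omega
              have a5 : ¬ (1 = n) := by omega
              have a12 : n ≠ 0 := by omega
              by_cases a6 : k.val + 1 = n
              · have : k.val = n - 1 := by omega
                have a7 : ¬ (n - 1 = 0) := by omega
                have a8 : ¬ (0 = n - 1) := by omega
                have a9 : ¬ (n - 1 = 1) := by omega
                have a10 : ¬ (1 = n - 1) := by omega
                have a11 : n - 1 + 1 = n := by omega
                simp [this, a7, a8, a9, a10, a11, a12]
              · have : ¬ k.val = n - 1 := by omega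
                simp [a1, a2, a3, a4, a5, a6, this]
        simp only [e, Finset.sum_add_distrib, Finset.sum_ite_eq', Finset.mem_univ, if_true]
        rw [h] at hr ⊢
        simp only [zero_add] at hr ⊢
        linear_combination -hr + h0
      · by_cases hl : i.val + 1 = n
        · have e : ∀ k : Fin n, L α n i k * f (k.val + 1)
              = (if k = ⟨0, by omega⟩ then -α * f 1 else 0)
                + (if k = ⟨i.val - 1, by omega⟩ then -f i.val else 0)
                + (if k = ⟨i.val, by omega⟩ then (1 + α) * f n else 0) := by
            intro k
            have hk := k.isLt
            simp only [L, Matrix.of_apply, Fin.ext_iff]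
            have b1 : ¬ (i.val = 0) := by omega
            have b2 : ¬ (i.val + 1 = k.val) := by omega
            by_cases c1 : k.val = i.val
            · have b3 : ¬ (i.val = i.val - 1) := by omega
              simp [c1, b1, b3, hl]
            · by_cases c2 : k.val + 1 = i.val
              · have b3 : k.val = i.val - 1 := by omega
                have b4 : ¬ (k.val = 0) := by omega
                have b5 : ¬ (i.val = i.val - 1) := by omega
                have b6 : ¬ (i.val - 1 = 0) := by omega
                have b7 : ¬ (i.val - 1 = i.val) := by omega
                have b8 : i.val - 1 + 1 = i.val := by omega
                simp [b3, b5, b6, b7, b8]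
              · have b3 : ¬ (k.val = i.val - 1) := by omega
                have b4 : ¬ (i.val = k.val) := by omega
                by_cases c3 : k.val = 0
                · simp_all
                · simp [b1, b2, b3, b4, c1, c2, c3]
          simp only [e, Finset.sum_add_distrib, Finset.sum_ite_eq', Finset.mem_univ, if_true]
          have e2 : i.val + 2 = n + 1 := by omega
          rw [e2, hl] at hr
          rw [hl]
          linear_combination -hr + h1
        · have e : ∀ k : Fin n, L α n i k * f (k.val + 1)
              = (if k = ⟨i.val, by omega⟩ then 2 * f (i.val + 1) else 0)
                + (if k = ⟨i.val - 1, by omega⟩ then -f i.val else 0)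
                + (if k = ⟨i.val + 1, by omega⟩ then -f (i.val + 2) else 0) := by
            intro k
            have hk := k.isLt
            simp only [L, Matrix.of_apply, Fin.ext_iff]
            have b1 : ¬ (i.val = 0) := by omega
            by_cases c1 : k.val = i.val
            · have b3 : ¬ (i.val = i.val - 1) := by omega
              simp [c1, b1, b3, hl]
            · by_cases c2 : k.val + 1 = i.val
              · have b3 : k.val = i.val - 1 := by omega
                have b5 : ¬ (i.val = i.val - 1) := by omega
                have b7 : ¬ (i.val - 1 = i.val) := by omega
                have b8 : i.val - 1 + 1 = i.val := by omega
                have b9 : ¬ (i.val - 1 = i.val + 1) := by omega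
                simp [b3, b5, b7, b8, b9]
              · have b3 : ¬ (k.val = i.val - 1) := by omega
                have b4 : ¬ (i.val = k.val) := by omega
                by_cases c3 : k.val = i.val + 1
                · have b5 : ¬ (i.val + 1 = i.val - 1) := by omega
                  simp [c3, b5]
                · have b6 : ¬ (i.val + 1 = k.val) := by omega
                  simp [b1, b3, b4, b6, c1, c2, c3, hl]
          simp only [e, Finset.sum_add_distrib, Finset.sum_ite_eq', Finset.mem_univ, if_true]
          linear_combination -hr
    ext i
    simp only [Matrix.sub_mulVec, Pi.sub_apply, Pi.zero_apply, sub_eq_zero]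
    rw [Matrix.scalar_apply, Matrix.mulVec_diagonal]
    exact (key i).symm

/-- An increasing list of `n` real roots of the characteristic polynomial is the list of
eigenvalues. -/
theorem eigval_eq_of_strictMono {α : ℂ} {n : ℕ} {lam : ℕ → ℝ}
    (hmono : ∀ i, i + 1 < n → lam i < lam (i + 1))
    (hroot : ∀ i < n, (L α n).charpoly.IsRoot (lam i : ℂ)) {j : ℕ} (hj : j < n) :
    eigval α n (j + 1) = lam j := by
  have hlt : ∀ i k, i < k → k < n → lam i < lam k := by
    intro i k hik
    induction k, hik using Nat.le_induction with
    | base => exact fun h => hmono i h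
    | succ k hk ih => exact fun h => (ih (by omega)).trans (hmono k h)
  set l : List ℝ := (List.range n).map lam with hl
  have hsorted : l.Pairwise (· ≤ ·) := by
    rw [hl, List.pairwise_map]
    refine (List.pairwise_lt_range (n := n)).imp_of_mem ?_
    intro a b _ hb hab
    exact (hlt a b hab (List.mem_range.mp hb)).le
  have hnodup : (l.map (fun x : ℝ => (x : ℂ))).Nodup := by
    rw [hl, List.map_map]
    refine List.Nodup.map_on ?_ List.nodup_range
    intro a ha b hb hab
    have ha := List.mem_range.mp ha
    have hb := List.mem_range.mp hb
    have hab : lam a = lam b := Complex.ofReal_injective hab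
    rcases lt_trichotomy a b with h | h | h
    · exact absurd hab (hlt a b h hb).ne
    · exact h
    · exact absurd hab (hlt b a h ha).ne'
  have hcp : (L α n).charpoly ≠ 0 := (Matrix.charpoly_monic _).ne_zero
  have hroots : (L α n).charpoly.roots
      = ((l.map (fun x : ℝ => (x : ℂ)) : List ℂ) : Multiset ℂ) := by
    symm
    -- The n distinct roots already exhaust the degree, so there are no others and all are simple.
    apply Multiset.eq_of_le_of_card_le
    · rw [Multiset.le_iff_subset (by exact_mod_cast hnodup)]
      intro x hx
      rw [Polynomial.mem_roots hcp]
      simp only [hl, Multiset.mem_coe, List.mem_map, List.mem_range] at hx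
      obtain ⟨y, ⟨i, hi, rfl⟩, rfl⟩ := hx
      exact hroot i hi
    · refine (Polynomial.card_roots' _).trans ?_
      rw [Matrix.charpoly_natDegree_eq_dim]
      simp [hl]
  unfold eigval
  rw [hroots]
  have : Multiset.map Complex.re ((l.map (fun x : ℝ => (x : ℂ)) : List ℂ) : Multiset ℂ)
      = (l : Multiset ℝ) := by
    simp [Function.comp_def]
  rw [this, Multiset.coe_sort, List.mergeSort_eq_self _ (by simpa using hsorted)]
  simp [hl, hj]

/-- When the values at both ends agree, α cancels from both boundary conditions. -/
theorem isRoot_charpoly_of_even {α : ℂ} {n : ℕ} (hn : 3 ≤ n) {lam : ℝ} {p : ℕ → ℝ}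
    (hp : ∀ k, p k + p (k + 2) = (2 - lam) * p (k + 1))
    (h0 : p 0 = p 1) (h1 : p n = p 1) (h2 : p (n + 1) = p 1) (hne : p 1 ≠ 0) :
    (L α n).charpoly.IsRoot (lam : ℂ) := by
  refine isRoot_charpoly_of_recurrence hn (f := fun k => (p k : ℂ)) ?_ ?_ ?_
    ⟨0, by omega, by simpa using hne⟩
  · intro k _
    exact_mod_cast hp k
  · simp only [h0, h1]; ring
  · simp only [h2, h1]; ring

/-- For f = A p + B q, with p even and q odd under the reflection, the sum of the boundary
conditions reads A(p(n+1) - p(n)) = (ᾱ - α) B q(n), which fixes the ratio A : B. Their difference is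
B times `hT`, so only Re α enters the eigenvalue equation. -/
theorem isRoot_charpoly_of_mixed {α : ℂ} {n : ℕ} (hn : 3 ≤ n) {lam : ℝ} {p q : ℕ → ℝ}
    (hp : ∀ k, p k + p (k + 2) = (2 - lam) * p (k + 1))
    (hq : ∀ k, q k + q (k + 2) = (2 - lam) * q (k + 1))
    (hp0 : p 0 = p (n + 1)) (hp1 : p 1 = p n) (hq0 : q 0 = -q (n + 1)) (hq1 : q 1 = -q n)
    (hpn : p (n + 1) ≠ p n) (hqn : q n ≠ 0) (hT : q (n + 1) = (1 - 2 * α.re) * q n) :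
    (L α n).charpoly.IsRoot (lam : ℂ) := by
  have hre : (starRingEnd ℂ) α + α = 2 * (α.re : ℂ) := by
    apply Complex.ext <;> simp; ring
  have hTc : (q (n + 1) : ℂ) = (1 - 2 * (α.re : ℂ)) * q n := by rw [hT]; push_cast; ring
  set f : ℕ → ℂ := fun k =>
    (q n * ((starRingEnd ℂ) α - α)) * p k + (p (n + 1) - p n) * q k with hf
  refine isRoot_charpoly_of_recurrence hn (f := f) ?_ ?_ ?_ ?_
  · intro k _
    have h1 : (p k : ℂ) + p (k + 2) = (2 - lam) * p (k + 1) := by exact_mod_cast hp k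
    have h2 : (q k : ℂ) + q (k + 2) = (2 - lam) * q (k + 1) := by exact_mod_cast hq k
    simp only [hf]
    linear_combination (q n * ((starRingEnd ℂ) α - α)) * h1 + ((p (n + 1) : ℂ) - p n) * h2
  · simp only [hf, hp0, hp1, hq0, hq1]
    push_cast
    linear_combination (-((p (n + 1) : ℂ) - p n)) * hTc - (p (n + 1) - p n) * q n * hre
  · simp only [hf, hp1, hq1]
    push_cast
    linear_combination (((p (n + 1) : ℂ) - p n)) * hTc + (p (n + 1) - p n) * q n * hre
  · by_contra hcon
    push Not at hcon
    -- The even part drops out of f(n) - f(1) = 2 B q(n), which is nonzero.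
    have e1 := hcon 0 (by omega)
    have e2 := hcon (n - 1) (by omega)
    rw [show n - 1 + 1 = n by omega] at e2
    simp only [hf, zero_add, hp1, hq1] at e1 e2
    push_cast at e1
    have e3 : ((p (n + 1) : ℂ) - p n) * q n = 0 := by linear_combination (e2 - e1) / 2
    have e4 : (p (n + 1) - p n) * q n = 0 := by exact_mod_cast e3
    rcases mul_eq_zero.mp e4 with h | h
    · exact hpn (by linarith)
    · exact hqn h

theorem g_eq (x : ℝ) : g x = 2 - 2 * cos x := by
  unfold g
  have : cos x = 1 - 2 * sin (x / 2) ^ 2 := by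
    have := cos_two_mul (x / 2)
    rw [show 2 * (x / 2) = x by ring] at this
    rw [this, cos_sq']; ring
  rw [this]; ring

theorem isRoot_charpoly_g_of_sin {α : ℂ} {n : ℕ} (hn : 3 ≤ n) {x : ℝ}
    (hs : sin (n * (x / 2)) = 0) (hc : cos (x / 2) ≠ 0) :
    (L α n).charpoly.IsRoot (g x : ℂ) := by
  have hcn : cos (n * (x / 2)) ≠ 0 := by
    intro h
    have := sin_sq_add_cos_sq (n * (x / 2))
    rw [h, hs] at this
    norm_num at this
  refine isRoot_charpoly_of_even hn
    -- The phase centres the cosine at k = (n + 1)/2, turning the reflection into t ↦ -t.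
    (p := fun k => cos ((2 * k - 1 - n) * (x / 2))) ?_ ?_ ?_ ?_ ?_
  · intro k
    rw [g_eq]
    push_cast
    rw [show (2 * (k : ℝ) - 1 - n) * (x / 2) = (2 * ((k : ℝ) + 1) - 1 - n) * (x / 2) - x by ring,
      show (2 * ((k : ℝ) + 2) - 1 - n) * (x / 2) = (2 * ((k : ℝ) + 1) - 1 - n) * (x / 2) + x by ring,
      cos_sub, cos_add]
    ring
  · push_cast
    rw [show (2 * (0 : ℝ) - 1 - n) * (x / 2) = -(n * (x / 2) + x / 2) by ring,
      show (2 * (1 : ℝ) - 1 - n) * (x / 2) = -(n * (x / 2) - x / 2) by ring,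
      cos_neg, cos_neg, cos_sub, cos_add, hs]
    ring
  · push_cast
    rw [show (2 * (n : ℝ) - 1 - n) * (x / 2) = -((2 * (1 : ℝ) - 1 - n) * (x / 2)) by ring, cos_neg]
  · push_cast
    rw [show (2 * ((n : ℝ) + 1) - 1 - n) * (x / 2) = n * (x / 2) + x / 2 by ring,
      show (2 * (1 : ℝ) - 1 - n) * (x / 2) = -(n * (x / 2) - x / 2) by ring,
      cos_neg, cos_sub, cos_add, hs]
    ring
  · push_cast
    rw [show (2 * (1 : ℝ) - 1 - n) * (x / 2) = -(n * (x / 2) - x / 2) by ring,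
      cos_neg, cos_sub, hs, zero_mul, add_zero]
    exact mul_ne_zero hcn hc

theorem re_mul_kappa {α : ℂ} (hα : α.re < 0) : α.re * kappa α = α.re - 1 := by
  unfold kappa
  field_simp [hα.ne]

theorem one_lt_kappa {α : ℂ} (hα : α.re < 0) : 1 < kappa α := by
  have := re_mul_kappa hα
  nlinarith

/-- The hypothesis `hx` is tan(nx/2) = ϰ tan(x/2) cleared of denominators. Expanding sin(nx/2 ± x/2)
and using Re(α)ϰ = Re(α) - 1 turns it into the odd-part condition of `isRoot_charpoly_of_mixed`. -/
theorem isRoot_charpoly_g_of_kappa {α : ℂ} (hα : α.re < 0) {n : ℕ} (hn : 3 ≤ n) {x : ℝ}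
    (hs : sin (x / 2) ≠ 0) (hc : cos (x / 2) ≠ 0)
    (hx : sin (n * (x / 2)) * cos (x / 2) = kappa α * sin (x / 2) * cos (n * (x / 2))) :
    (L α n).charpoly.IsRoot (g x : ℂ) := by
  have hk := re_mul_kappa hα
  have hk1 := one_lt_kappa hα
  have hone := sin_sq_add_cos_sq (n * (x / 2))
  have hcn : cos (n * (x / 2)) ≠ 0 := by
    intro h
    rw [h] at hx hone
    have : sin (n * (x / 2)) = 0 := by simpa [hc] using hx
    rw [this] at hone
    norm_num at hone
  have hsn : sin (n * (x / 2)) ≠ 0 := by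
    intro h
    rw [h, zero_mul] at hx
    have : kappa α ≠ 0 := by linarith
    exact (mul_ne_zero (mul_ne_zero this hs) hcn) hx.symm
  have eT : (2 * ((n : ℝ) + 1) - 1 - n) * (x / 2) = n * (x / 2) + x / 2 := by ring
  have et : (2 * (n : ℝ) - 1 - n) * (x / 2) = n * (x / 2) - x / 2 := by ring
  refine isRoot_charpoly_of_mixed hn
    (p := fun k => cos ((2 * k - 1 - n) * (x / 2)))
    (q := fun k => sin ((2 * k - 1 - n) * (x / 2))) ?_ ?_ ?_ ?_ ?_ ?_ ?_ ?_ ?_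
  · intro k
    rw [g_eq]
    push_cast
    rw [show (2 * (k : ℝ) - 1 - n) * (x / 2) = (2 * ((k : ℝ) + 1) - 1 - n) * (x / 2) - x by ring,
      show (2 * ((k : ℝ) + 2) - 1 - n) * (x / 2) = (2 * ((k : ℝ) + 1) - 1 - n) * (x / 2) + x by ring,
      cos_sub, cos_add]
    ring
  · intro k
    rw [g_eq]
    push_cast
    rw [show (2 * (k : ℝ) - 1 - n) * (x / 2) = (2 * ((k : ℝ) + 1) - 1 - n) * (x / 2) - x by ring,
      show (2 * ((k : ℝ) + 2) - 1 - n) * (x / 2) = (2 * ((k : ℝ) + 1) - 1 - n) * (x / 2) + x by ring,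
      sin_sub, sin_add]
    ring
  · push_cast
    rw [← cos_neg]; ring_nf
  · rw [← cos_neg]; push_cast; ring_nf
  · push_cast
    rw [← sin_neg]; ring_nf
  · push_cast
    rw [← sin_neg]; ring_nf
  · push_cast
    rw [eT, et, cos_add, cos_sub]
    intro h
    exact mul_ne_zero hsn hs (by linarith)
  · rw [et, sin_sub, hx]
    intro h
    have : (kappa α - 1) * (sin (x / 2) * cos (n * (x / 2))) = 0 := by linear_combination h
    exact mul_ne_zero (by linarith) (mul_ne_zero hs hcn) this
  · push_cast
    rw [eT, et, sin_add, sin_sub]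
    linear_combination (2 * α.re) * hx + 2 * sin (x / 2) * cos (n * (x / 2)) * hk

theorem isRoot_charpoly_gMinus_of_kappa {α : ℂ} (hα : α.re < 0) {n : ℕ} (hn : 3 ≤ n) {x : ℝ}
    (hx0 : 0 < x)
    (hx : sinh (n * (x / 2)) * cosh (x / 2) = kappa α * sinh (x / 2) * cosh (n * (x / 2))) :
    (L α n).charpoly.IsRoot (gMinus x : ℂ) := by
  have hk := re_mul_kappa hα
  have hk1 := one_lt_kappa hα
  have hn0 : (0 : ℝ) < n := by exact_mod_cast (by omega : 0 < n)
  have hs : 0 < sinh (x / 2) := sinh_pos_iff.mpr (by positivity)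
  have hsn : 0 < sinh (n * (x / 2)) := sinh_pos_iff.mpr (by positivity)
  have hcn := cosh_pos (n * (x / 2))
  have eT : (2 * ((n : ℝ) + 1) - 1 - n) * (x / 2) = n * (x / 2) + x / 2 := by ring
  have et : (2 * (n : ℝ) - 1 - n) * (x / 2) = n * (x / 2) - x / 2 := by ring
  refine isRoot_charpoly_of_mixed hn
    (p := fun k => cosh ((2 * k - 1 - n) * (x / 2)))
    (q := fun k => sinh ((2 * k - 1 - n) * (x / 2))) ?_ ?_ ?_ ?_ ?_ ?_ ?_ ?_ ?_
  · intro k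
    unfold gMinus
    push_cast
    rw [show (2 * (k : ℝ) - 1 - n) * (x / 2) = (2 * ((k : ℝ) + 1) - 1 - n) * (x / 2) - x by ring,
      show (2 * ((k : ℝ) + 2) - 1 - n) * (x / 2) = (2 * ((k : ℝ) + 1) - 1 - n) * (x / 2) + x by ring,
      cosh_sub, cosh_add]
    ring
  · intro k
    unfold gMinus
    push_cast
    rw [show (2 * (k : ℝ) - 1 - n) * (x / 2) = (2 * ((k : ℝ) + 1) - 1 - n) * (x / 2) - x by ring,
      show (2 * ((k : ℝ) + 2) - 1 - n) * (x / 2) = (2 * ((k : ℝ) + 1) - 1 - n) * (x / 2) + x by ring,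
      sinh_sub, sinh_add]
    ring
  · push_cast
    rw [← cosh_neg]; ring_nf
  · rw [← cosh_neg]; push_cast; ring_nf
  · push_cast
    rw [← sinh_neg]; ring_nf
  · push_cast
    rw [← sinh_neg]; ring_nf
  · push_cast
    rw [eT, et, cosh_add, cosh_sub]
    intro h
    exact (mul_pos hsn hs).ne' (by linarith)
  · rw [et, sinh_sub, hx]
    intro h
    have : (kappa α - 1) * (sinh (x / 2) * cosh (n * (x / 2))) = 0 := by linear_combination h
    exact mul_ne_zero (by linarith) (mul_pos hs hcn).ne' this
  · push_cast
    rw [eT, et, sinh_add, sinh_sub]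
    linear_combination (2 * α.re) * hx + 2 * sinh (x / 2) * cosh (n * (x / 2)) * hk

/-! ### Localisation and ordering of the eigenvalues. -/

theorem strictMonoOn_g : StrictMonoOn g (Set.Icc 0 π) := by
  intro x hx y hy hxy
  rw [g_eq, g_eq]
  linarith [strictAntiOn_cos hx hy hxy]

theorem injOn_gMinus : Set.InjOn gMinus (Set.Ici 0) := by
  intro x hx y hy hxy
  unfold gMinus at hxy
  exact cosh_strictMonoOn.injOn hx hy (by linarith)

theorem exists_kappa_root {α : ℂ} (hα : α.re < 0) {n k : ℕ} (hk : 1 ≤ k) (hkn : 2 * k + 1 < n) :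
    ∃ x ∈ Set.Ioo (2 * k * π / n) ((2 * k + 1) * π / n),
      sin (n * (x / 2)) * cos (x / 2) = kappa α * sin (x / 2) * cos (n * (x / 2)) := by
  have hk1 := one_lt_kappa hα
  have hn : (0 : ℝ) < n := by exact_mod_cast (by omega : 0 < n)
  have hk0 : (0 : ℝ) < k := by exact_mod_cast hk
  have hkn' : 2 * (k : ℝ) + 1 < n := by exact_mod_cast hkn
  have hpi := pi_pos
  have hle : 2 * k * π / n ≤ (2 * k + 1) * π / n := by gcongr; linarith
  have hr : (2 * k + 1) * π / n < π := by
    rw [div_lt_iff₀ hn]; nlinarith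
  have hl0 : 0 < 2 * k * π / n := by positivity
  -- Subtracting kπ removes the sign (-1)^k: the sine term vanishes at the left endpoint and the
  -- cosine term at the right one, so G goes from negative to positive.
  set G : ℝ → ℝ := fun x => sin (n * (x / 2) - k * π) * cos (x / 2)
    - kappa α * sin (x / 2) * cos (n * (x / 2) - k * π) with hG
  have hcont : ContinuousOn G (Set.Icc (2 * k * π / n) ((2 * k + 1) * π / n)) := by
    apply Continuous.continuousOn
    fun_prop
  have e1 : n * ((2 * k * π / n) / 2) - k * π = 0 := by field_simp; ring
  have e2 : n * (((2 * k + 1) * π / n) / 2) - k * π = π / 2 := by field_simp; ring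
  have hmem : (0 : ℝ) ∈ Set.Ioo (G (2 * k * π / n)) (G ((2 * k + 1) * π / n)) := by
    constructor
    · simp only [hG, e1, sin_zero, cos_zero]
      have : 0 < sin (2 * k * π / n / 2) := sin_pos_of_pos_of_lt_pi (by positivity) (by linarith)
      nlinarith
    · simp only [hG, e2, sin_pi_div_two, cos_pi_div_two]
      have : 0 < cos ((2 * k + 1) * π / n / 2) :=
        cos_pos_of_mem_Ioo ⟨by linarith, by linarith⟩
      linarith
  obtain ⟨x, hx, hx0⟩ := intermediate_value_Ioo hle hcont hmem
  refine ⟨x, hx, ?_⟩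
  simp only [hG, sin_sub_nat_mul_pi, cos_sub_nat_mul_pi] at hx0
  have hne : ((-1 : ℝ)) ^ k ≠ 0 := pow_ne_zero _ (by norm_num)
  apply mul_left_cancel₀ hne
  linear_combination hx0

theorem mul_sinh_le_sinh_nat_mul {u : ℝ} (hu : 0 ≤ u) (n : ℕ) : n * sinh u ≤ sinh (n * u) := by
  induction n with
  | zero => simp
  | succ n ih =>
    push_cast
    rw [add_mul, one_mul, add_mul, one_mul, sinh_add]
    have h1 := one_le_cosh u
    have h2 := one_le_cosh (n * u)
    have h3 : 0 ≤ sinh u := sinh_nonneg_iff.mpr hu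
    have h4 : 0 ≤ sinh (n * u) := sinh_nonneg_iff.mpr (by positivity)
    nlinarith

theorem kappa_lt_of_N_le (α : ℂ) {n : ℕ} (hn : N α ≤ n) : kappa α < n := by
  have h1 := Nat.lt_floor_add_one (kappa α)
  have h2 : ⌊kappa α⌋₊ + 1 ≤ n := (le_max_right _ _).trans hn
  have h3 : ((⌊kappa α⌋₊ : ℝ) + 1) ≤ n := by exact_mod_cast h2
  linarith

theorem exp_omega {α : ℂ} (hα : α.re < 0) : exp (omega α) = 1 - 2 * α.re := by
  unfold omega
  rw [exp_log (by linarith)]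

theorem omega_pos {α : ℂ} (hα : α.re < 0) : 0 < omega α :=
  log_pos (by linarith)

/-- ω solves ϰ tanh(x/2) = 1, the limit of the hyperbolic equation as n → ∞. -/
theorem kappa_mul_sinh_omega {α : ℂ} (hα : α.re < 0) :
    kappa α * sinh (omega α / 2) = cosh (omega α / 2) := by
  have h := exp_omega hα
  have hk := re_mul_kappa hα
  have e : exp (omega α) = exp (omega α / 2) * exp (omega α / 2) := by rw [← exp_add]; ring_nf
  have e2 : exp (omega α / 2) * exp (-(omega α / 2)) = 1 := by rw [← exp_add]; simp
  have hp := exp_pos (-(omega α / 2))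
  rw [sinh_eq, cosh_eq]
  rw [h] at e
  apply mul_left_cancel₀ (mul_ne_zero hα.ne (exp_pos (omega α / 2)).ne')
  linear_combination (exp (omega α / 2) * (exp (omega α / 2) - exp (-(omega α / 2))) / 2) * hk
    + (1/2 : ℝ) * e - (2 * α.re - 1) / 2 * e2

/-- A lower bound for the solutions, uniform in `n`. -/
theorem exists_sinh_root {α : ℂ} (hα : α.re < 0) :
    ∃ s₀ > 0, ∀ n, N α ≤ n → ∃ x ∈ Set.Icc s₀ (omega α),
      sinh (n * (x / 2)) * cosh (x / 2) = kappa α * sinh (x / 2) * cosh (n * (x / 2)) := by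
  have hω := omega_pos hα
  have hkN := kappa_lt_of_N_le α le_rfl
  have hcont : Continuous fun u : ℝ => N α * cosh u - kappa α * cosh (N α * u) := by fun_prop
  -- At u = 0 this is `N α > ϰ`. A small u chosen for `N α` alone will serve every larger n.
  have hev : ∀ᶠ u in nhds (0 : ℝ), 0 < N α * cosh u - kappa α * cosh (N α * u) := by
    apply hcont.continuousAt.eventually_const_lt
    simpa using hkN
  obtain ⟨u, ⟨hu1, hu2⟩, hu0⟩ := ((hev.and (gt_mem_nhds (half_pos hω))).filter_mono
    nhdsWithin_le_nhds |>.and (self_mem_nhdsWithin (s := Set.Ioi (0 : ℝ)))).exists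
  have hu0 : 0 < u := hu0
  refine ⟨2 * u, by positivity, fun n hn => ?_⟩
  have hsu : 0 < sinh u := sinh_pos_iff.mpr hu0
  have hn' : (N α : ℝ) ≤ n := by exact_mod_cast hn
  set G : ℝ → ℝ := fun x => sinh (n * (x / 2)) * cosh (x / 2)
    - kappa α * sinh (x / 2) * cosh (n * (x / 2)) with hG
  have hcontG : ContinuousOn G (Set.Icc (2 * u) (omega α)) := by
    apply Continuous.continuousOn
    fun_prop
  have hmem : (0 : ℝ) ∈ Set.Icc (G (omega α)) (G (2 * u)) := by
    constructor
    · simp only [hG, kappa_mul_sinh_omega hα]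
      have := sinh_lt_cosh (n * (omega α / 2))
      nlinarith [cosh_pos (omega α / 2)]
    · simp only [hG, mul_div_cancel_left₀ u (two_ne_zero)]
      -- This is tanh(nu) ≥ tanh(Nu), which carries the sign at 2u from N to n.
      have h1 : 0 ≤ sinh (n * u - N α * u) := sinh_nonneg_iff.mpr (by nlinarith)
      rw [sinh_sub] at h1
      have h2 := mul_sinh_le_sinh_nat_mul hu0.le (N α)
      have hcu := cosh_pos u
      have hcN := cosh_pos (N α * u)
      have hcn := cosh_pos (n * u)
      have h3 : kappa α * sinh u * cosh (N α * u) ≤ sinh (N α * u) * cosh u := by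
        have := mul_le_mul_of_nonneg_right h2 hcu.le
        nlinarith
      have h4 := mul_le_mul_of_nonneg_right h3 hcn.le
      have h5 : 0 ≤ (sinh (n * u) * cosh (N α * u) - cosh (n * u) * sinh (N α * u)) * cosh u :=
        mul_nonneg h1 hcu.le
      refine nonneg_of_mul_nonneg_left ?_ hcN
      linarith
  obtain ⟨x, hx, hx0⟩ := intermediate_value_Icc' (by linarith) hcontG hmem
  exact ⟨x, hx, sub_eq_zero.mp hx0⟩

/-- The `(i + 1)`-th eigenvalue in terms of solutions of the characteristic equations. -/
noncomputable def eigSeq (n : ℕ) (σ : ℝ) (ζ : ℕ → ℝ) (i : ℕ) : ℝ :=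
  if i = 0 then gMinus σ else if i = 1 then 0 else if Even i then g (i * π / n) else g (ζ i)

/-- The index is i = j - 1. The points iπ/n for even i alternate with the `ζ i` for odd i, which
gives strict monotonicity, and each value is a root, so counting identifies the spectrum. -/
theorem eigval_eq_eigSeq {α : ℂ} (hα : α.re < 0) {n : ℕ} (hn : N α ≤ n) {σ : ℝ} {ζ : ℕ → ℝ}
    (hσ0 : 0 < σ)
    (hσ : sinh (n * (σ / 2)) * cosh (σ / 2) = kappa α * sinh (σ / 2) * cosh (n * (σ / 2)))
    (hζmem : ∀ i, 2 ≤ i → i < n → Odd i → ζ i ∈ Set.Ioo ((i - 1) * π / n) (i * π / n))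
    (hζ : ∀ i, 2 ≤ i → i < n → Odd i →
      sin (n * (ζ i / 2)) * cos (ζ i / 2) = kappa α * sin (ζ i / 2) * cos (n * (ζ i / 2)))
    {i : ℕ} (hi : i < n) : eigval α n (i + 1) = eigSeq n σ ζ i := by
  have hn3 : 3 ≤ n := (le_max_left _ _).trans hn
  have hn0 : (0 : ℝ) < n := by exact_mod_cast (by omega : 0 < n)
  have hpi := pi_pos
  have hnode : ∀ i : ℕ, i < n → (i : ℝ) * π / n ∈ Set.Ico 0 π := by
    intro i hi
    have : (i : ℝ) < n := by exact_mod_cast hi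
    exact ⟨by positivity, by rw [div_lt_iff₀ hn0]; nlinarith⟩
  have hζIcc : ∀ i, 2 ≤ i → i < n → Odd i → ζ i ∈ Set.Ioo 0 π := by
    intro i h2 hi ho
    obtain ⟨h3, h4⟩ := hζmem i h2 hi ho
    refine ⟨lt_of_le_of_lt ?_ h3, h4.trans (hnode i hi).2⟩
    have : (1 : ℝ) ≤ i := by exact_mod_cast (by omega : 1 ≤ i)
    have : (0 : ℝ) ≤ i - 1 := by linarith
    positivity
  refine eigval_eq_of_strictMono (lam := eigSeq n σ ζ) ?_ ?_ hi
  · intro i hi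
    unfold eigSeq
    rcases Nat.lt_or_ge i 2 with h | h
    · interval_cases i
      · simp only [if_true, zero_add, one_ne_zero, if_false]
        unfold gMinus
        linarith [one_lt_cosh.mpr hσ0.ne']
      · rw [if_neg (by omega), if_pos rfl, if_neg (by omega), if_neg (by omega),
          if_pos ⟨1, rfl⟩]
        have h0 : g 0 = 0 := by simp [g]
        rw [← h0]
        have hm := hnode (1 + 1) hi
        apply strictMonoOn_g ⟨le_rfl, hpi.le⟩ ⟨hm.1, hm.2.le⟩
        push_cast
        positivity
    · rw [if_neg (show i ≠ 0 by omega), if_neg (show i ≠ 1 by omega),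
        if_neg (show i + 1 ≠ 0 by omega), if_neg (show i + 1 ≠ 1 by omega)]
      rcases Nat.even_or_odd i with he | ho
      · have ho1 : Odd (i + 1) := he.add_one
        rw [if_pos he, if_neg (Nat.not_even_iff_odd.mpr ho1)]
        have hm := hnode i (by omega)
        have hz := hζIcc (i + 1) (by omega) hi ho1
        apply strictMonoOn_g ⟨hm.1, hm.2.le⟩ ⟨hz.1.le, hz.2.le⟩
        have := (hζmem (i + 1) (by omega) hi ho1).1
        push_cast at this
        rwa [add_sub_cancel_right] at this
      · have he1 : Even (i + 1) := ho.add_one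
        rw [if_neg (Nat.not_even_iff_odd.mpr ho), if_pos he1]
        have hm := hnode (i + 1) hi
        have hz := hζIcc i (by omega) (by omega) ho
        apply strictMonoOn_g ⟨hz.1.le, hz.2.le⟩ ⟨hm.1, hm.2.le⟩
        refine (hζmem i (by omega) (by omega) ho).2.trans ?_
        push_cast
        gcongr
        linarith
  · intro i hi
    unfold eigSeq
    split_ifs with h1 h2 h3
    · exact isRoot_charpoly_gMinus_of_kappa hα hn3 hσ0 hσ
    · have h0 : g 0 = 0 := by simp [g]
      rw [← h0]
      exact isRoot_charpoly_g_of_sin hn3 (by simp) (by simp)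
    · have hm := hnode i hi
      apply isRoot_charpoly_g_of_sin hn3
      · obtain ⟨k, rfl⟩ := h3
        rw [show n * (((k + k : ℕ) : ℝ) * π / n / 2) = k * π by push_cast; field_simp; ring]
        exact sin_nat_mul_pi k
      · exact (cos_pos_of_mem_Ioo ⟨by linarith [hm.1], by linarith [hm.2]⟩).ne'
    · have ho := Nat.not_even_iff_odd.mp h3
      have hz := hζIcc i (by omega) hi ho
      apply isRoot_charpoly_g_of_kappa hα hn3 _ _ (hζ i (by omega) hi ho)
      · exact (sin_pos_of_pos_of_lt_pi (by linarith [hz.1]) (by linarith [hz.1, hz.2])).ne'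
      · exact (cos_pos_of_mem_Ioo ⟨by linarith [hz.1], by linarith [hz.2]⟩).ne'

theorem exists_inner_roots {α : ℂ} (hα : α.re < 0) (n : ℕ) : ∃ ζ : ℕ → ℝ,
    (∀ i, 2 ≤ i → i < n → Odd i → ζ i ∈ Set.Ioo ((i - 1) * π / n) (i * π / n)) ∧
    ∀ i, 2 ≤ i → i < n → Odd i →
      sin (n * (ζ i / 2)) * cos (ζ i / 2) = kappa α * sin (ζ i / 2) * cos (n * (ζ i / 2)) := by
  have h : ∀ i : ℕ, ∃ x : ℝ, 2 ≤ i → i < n → Odd i →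
      x ∈ Set.Ioo ((i - 1) * π / n) (i * π / n) ∧
      sin (n * (x / 2)) * cos (x / 2) = kappa α * sin (x / 2) * cos (n * (x / 2)) := by
    intro i
    by_cases hi : 2 ≤ i ∧ i < n ∧ Odd i
    · obtain ⟨h2, hin, k, rfl⟩ := hi
      obtain ⟨x, hx, hx'⟩ := exists_kappa_root hα (n := n) (k := k) (by omega) hin
      refine ⟨x, fun _ _ _ => ⟨?_, hx'⟩⟩
      push_cast
      rwa [add_sub_cancel_right]
    · exact ⟨0, fun h2 h3 h4 => absurd ⟨h2, h3, h4⟩ hi⟩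
  choose ζ hζ using h
  exact ⟨ζ, fun i h2 h3 h4 => (hζ i h2 h3 h4).1, fun i h2 h3 h4 => (hζ i h2 h3 h4).2⟩

theorem z_eq_of_eigval_eq {α : ℂ} {n j : ℕ} {x : ℝ} (hx : x ∈ Set.Icc 0 π)
    (h : eigval α n j = g x) : z α n j = x := by
  unfold z
  rw [h]
  exact strictMonoOn_g.injOn.leftInvOn_invFunOn hx

theorem z_of_odd {α : ℂ} (hα : α.re < 0) {n j : ℕ} (hn : N α ≤ n) (hj : 3 ≤ j) (hjn : j ≤ n)
    (ho : Odd j) : z α n j = (j - 1) * π / n ∧ eigval α n j = g ((j - 1) * π / n) := by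
  obtain ⟨s₀, hs₀, hs⟩ := exists_sinh_root hα
  obtain ⟨x, hx, hx'⟩ := hs n hn
  obtain ⟨ζ, hζ, hζ'⟩ := exists_inner_roots hα n
  obtain ⟨i, rfl⟩ : ∃ i, j = i + 1 := ⟨j - 1, by omega⟩
  have h := eigval_eq_eigSeq hα hn (lt_of_lt_of_le hs₀ hx.1) hx' hζ hζ' (i := i) (by omega)
  have he : Even i := by
    by_contra hcon
    exact (Nat.not_even_iff_odd.mpr ho) (Nat.not_even_iff_odd.mp hcon).add_one
  rw [eigSeq, if_neg (by omega), if_neg (by omega), if_pos he] at h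
  have hn0 : (0 : ℝ) < n := by exact_mod_cast (by omega : 0 < n)
  have hin : (i : ℝ) ≤ n := by exact_mod_cast (by omega : i ≤ n)
  push_cast
  rw [add_sub_cancel_right]
  refine ⟨z_eq_of_eigval_eq ⟨by positivity, ?_⟩ h, h⟩
  rw [div_le_iff₀ hn0]
  nlinarith [pi_pos]

theorem z_of_even {α : ℂ} (hα : α.re < 0) {n j : ℕ} (hn : N α ≤ n) (hj : 3 ≤ j) (hjn : j ≤ n)
    (he : Even j) : z α n j ∈ Set.Ioo ((j - 2) * π / n) ((j - 1) * π / n) ∧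
      sin (n * (z α n j / 2)) * cos (z α n j / 2)
        = kappa α * sin (z α n j / 2) * cos (n * (z α n j / 2)) := by
  obtain ⟨s₀, hs₀, hs⟩ := exists_sinh_root hα
  obtain ⟨x, hx, hx'⟩ := hs n hn
  obtain ⟨ζ, hζ, hζ'⟩ := exists_inner_roots hα n
  obtain ⟨i, rfl⟩ : ∃ i, j = i + 1 := ⟨j - 1, by omega⟩
  have h := eigval_eq_eigSeq hα hn (lt_of_lt_of_le hs₀ hx.1) hx' hζ hζ' (i := i) (by omega)
  have hodd : ¬ Even i := fun hcon => (Nat.not_even_iff_odd.mpr hcon.add_one) he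
  rw [eigSeq, if_neg (by omega), if_neg (by omega), if_neg hodd] at h
  have ho := Nat.not_even_iff_odd.mp hodd
  have hn0 : (0 : ℝ) < n := by exact_mod_cast (by omega : 0 < n)
  have hin : (i : ℝ) ≤ n := by exact_mod_cast (by omega : i ≤ n)
  have hi1 : (1 : ℝ) ≤ i := by exact_mod_cast (by omega : 1 ≤ i)
  have hm := hζ i (by omega) (by omega) ho
  have hpi := pi_pos
  have hz : z α n (i + 1) = ζ i := by
    refine z_eq_of_eigval_eq ⟨le_trans ?_ hm.1.le, hm.2.le.trans ?_⟩ h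
    · have : (0 : ℝ) ≤ i - 1 := by linarith
      positivity
    · rw [div_le_iff₀ hn0]
      nlinarith
  rw [hz]
  push_cast
  rw [add_sub_cancel_right, show (i : ℝ) + 1 - 2 = i - 1 by ring]
  exact ⟨hm, hζ' i (by omega) (by omega) ho⟩

theorem exists_lower_bound_s {α : ℂ} (hα : α.re < 0) :
    ∃ s₀ > 0, ∀ n, N α ≤ n → s α n ∈ Set.Icc s₀ (omega α) ∧
      sinh (n * (s α n / 2)) * cosh (s α n / 2)
        = kappa α * sinh (s α n / 2) * cosh (n * (s α n / 2)) := by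
  obtain ⟨s₀, hs₀, hs⟩ := exists_sinh_root hα
  refine ⟨s₀, hs₀, fun n hn => ?_⟩
  obtain ⟨x, hx, hx'⟩ := hs n hn
  obtain ⟨ζ, hζ, hζ'⟩ := exists_inner_roots hα n
  have hn3 : 3 ≤ n := (le_max_left _ _).trans hn
  have hx0 := lt_of_lt_of_le hs₀ hx.1
  have h := eigval_eq_eigSeq hα hn hx0 hx' hζ hζ' (i := 0) (by omega)
  rw [eigSeq, if_pos rfl, zero_add] at h
  have hsx : s α n = x := by
    unfold s
    rw [h]
    exact injOn_gMinus.leftInvOn_invFunOn hx0.le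
  rw [hsx]
  exact ⟨hx, hx'⟩

/-! ### Closed forms for the squared norms. -/

theorem sum_cos_symm (n : ℕ) {x : ℝ} (hx : sin x ≠ 0) :
    ∑ i : Fin n, cos ((2 * (i.val : ℝ) + 1 - n) * x) = sin (n * x) / sin x := by
  rw [Fin.sum_univ_eq_sum_range (fun i => cos ((2 * (i : ℝ) + 1 - n) * x)), eq_div_iff hx]
  -- Multiplication by 2 sin x makes the sum telescope.
  have h := Finset.sum_range_sub (fun i : ℕ => sin ((2 * (i : ℝ) - n) * x)) n
  have e : ∀ i : ℕ, sin ((2 * ((i + 1 : ℕ) : ℝ) - n) * x) - sin ((2 * (i : ℝ) - n) * x)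
      = 2 * (cos ((2 * (i : ℝ) + 1 - n) * x) * sin x) := by
    intro i
    push_cast
    rw [show (2 * ((i : ℝ) + 1) - n) * x = (2 * (i : ℝ) + 1 - n) * x + x by ring,
      show (2 * (i : ℝ) - n) * x = (2 * (i : ℝ) + 1 - n) * x - x by ring, sin_add, sin_sub]
    ring
  simp only [e, ← Finset.mul_sum, ← Finset.sum_mul] at h
  rw [show (2 * (n : ℝ) - n) * x = n * x by ring,
    show (2 * ((0 : ℕ) : ℝ) - n) * x = -(n * x) by push_cast; ring, sin_neg] at h
  linarith

theorem sum_sin_symm (n : ℕ) {x : ℝ} (hx : sin x ≠ 0) :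
    ∑ i : Fin n, sin ((2 * (i.val : ℝ) + 1 - n) * x) = 0 := by
  rw [Fin.sum_univ_eq_sum_range (fun i => sin ((2 * (i : ℝ) + 1 - n) * x))]
  have h := Finset.sum_range_sub (fun i : ℕ => cos ((2 * (i : ℝ) - n) * x)) n
  have e : ∀ i : ℕ, cos ((2 * ((i + 1 : ℕ) : ℝ) - n) * x) - cos ((2 * (i : ℝ) - n) * x)
      = -2 * (sin ((2 * (i : ℝ) + 1 - n) * x) * sin x) := by
    intro i
    push_cast
    rw [show (2 * ((i : ℝ) + 1) - n) * x = (2 * (i : ℝ) + 1 - n) * x + x by ring,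
      show (2 * (i : ℝ) - n) * x = (2 * (i : ℝ) + 1 - n) * x - x by ring, cos_add, cos_sub]
    ring
  simp only [e, ← Finset.mul_sum, ← Finset.sum_mul] at h
  rw [show (2 * (n : ℝ) - n) * x = n * x by ring,
    show (2 * ((0 : ℕ) : ℝ) - n) * x = -(n * x) by push_cast; ring, cos_neg, sub_self] at h
  have h2 : (∑ i ∈ Finset.range n, sin ((2 * (i : ℝ) + 1 - n) * x)) * sin x = 0 := by linarith
  exact (mul_eq_zero.mp h2).resolve_right hx

theorem sum_cosh_symm (n : ℕ) {x : ℝ} (hx : sinh x ≠ 0) :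
    ∑ i : Fin n, cosh ((2 * (i.val : ℝ) + 1 - n) * x) = sinh (n * x) / sinh x := by
  rw [Fin.sum_univ_eq_sum_range (fun i => cosh ((2 * (i : ℝ) + 1 - n) * x)), eq_div_iff hx]
  have h := Finset.sum_range_sub (fun i : ℕ => sinh ((2 * (i : ℝ) - n) * x)) n
  have e : ∀ i : ℕ, sinh ((2 * ((i + 1 : ℕ) : ℝ) - n) * x) - sinh ((2 * (i : ℝ) - n) * x)
      = 2 * (cosh ((2 * (i : ℝ) + 1 - n) * x) * sinh x) := by
    intro i
    push_cast
    rw [show (2 * ((i : ℝ) + 1) - n) * x = (2 * (i : ℝ) + 1 - n) * x + x by ring,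
      show (2 * (i : ℝ) - n) * x = (2 * (i : ℝ) + 1 - n) * x - x by ring, sinh_add, sinh_sub]
    ring
  simp only [e, ← Finset.mul_sum, ← Finset.sum_mul] at h
  rw [show (2 * (n : ℝ) - n) * x = n * x by ring,
    show (2 * ((0 : ℕ) : ℝ) - n) * x = -(n * x) by push_cast; ring, sinh_neg] at h
  linarith

theorem sum_sinh_symm (n : ℕ) {x : ℝ} (hx : sinh x ≠ 0) :
    ∑ i : Fin n, sinh ((2 * (i.val : ℝ) + 1 - n) * x) = 0 := by
  rw [Fin.sum_univ_eq_sum_range (fun i => sinh ((2 * (i : ℝ) + 1 - n) * x))]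
  have h := Finset.sum_range_sub (fun i : ℕ => cosh ((2 * (i : ℝ) - n) * x)) n
  have e : ∀ i : ℕ, cosh ((2 * ((i + 1 : ℕ) : ℝ) - n) * x) - cosh ((2 * (i : ℝ) - n) * x)
      = 2 * (sinh ((2 * (i : ℝ) + 1 - n) * x) * sinh x) := by
    intro i
    push_cast
    rw [show (2 * ((i : ℝ) + 1) - n) * x = (2 * (i : ℝ) + 1 - n) * x + x by ring,
      show (2 * (i : ℝ) - n) * x = (2 * (i : ℝ) + 1 - n) * x - x by ring, cosh_add, cosh_sub]
    ring
  simp only [e, ← Finset.mul_sum, ← Finset.sum_mul] at h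
  rw [show (2 * (n : ℝ) - n) * x = n * x by ring,
    show (2 * ((0 : ℕ) : ℝ) - n) * x = -(n * x) by push_cast; ring, cosh_neg, sub_self] at h
  have h2 : (∑ i ∈ Finset.range n, sinh ((2 * (i : ℝ) + 1 - n) * x)) * sinh x = 0 := by linarith
  exact (mul_eq_zero.mp h2).resolve_right hx

theorem norm_sq_ofReal_combination (α : ℂ) (u v w : ℝ) :
    ‖(u : ℂ) - (1 - (starRingEnd ℂ) α) * (v : ℂ) + (starRingEnd ℂ) α * (w : ℂ)‖ ^ 2
      = (u - v + α.re * (v + w)) ^ 2 + (α.im * (v + w)) ^ 2 := by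
  rw [← Complex.normSq_eq_norm_sq, Complex.normSq_apply]
  simp
  ring

/-- Measured from the centre by t, a component has real part 2(a cos t - B sin t) and imaginary part
±2b cos t. After squaring, only the constant and cos 2t terms survive the summation, by symmetry. -/
theorem norm_sq_innerVec (α : ℂ) (n j : ℕ) (hz : sin (z α n j) ≠ 0) :
    ‖innerVec α n j‖ ^ 2 =
      2 * ((sin (z α n j / 2) * cos (n * (z α n j / 2))
              + α.re * sin (n * (z α n j / 2) - z α n j / 2)) ^ 2
            + (α.im * sin (n * (z α n j / 2) - z α n j / 2)) ^ 2)
          * (n + sin (n * z α n j) / sin (z α n j))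
        + 2 * sin (z α n j / 2) ^ 2 * sin (n * (z α n j / 2)) ^ 2
          * (n - sin (n * z α n j) / sin (z α n j)) := by
  rw [EuclideanSpace.norm_sq_eq, ← sum_cos_symm n hz]
  have h0 := sum_sin_symm n hz
  simp only [innerVec]
  generalize z α n j = x at *
  set a := sin (x / 2) * cos (n * (x / 2)) + α.re * sin (n * (x / 2) - x / 2)
  set b := α.im * sin (n * (x / 2) - x / 2)
  set B := sin (x / 2) * sin (n * (x / 2)) with hB
  have e : ∀ i : Fin n, ‖((sin (((i.val : ℝ) + 1) * x) : ℝ) : ℂ)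
      - (1 - (starRingEnd ℂ) α) * ((sin (((i.val : ℝ) + 1 - 1) * x) : ℝ) : ℂ)
      + (starRingEnd ℂ) α * ((sin (((n : ℝ) - ((i.val : ℝ) + 1)) * x) : ℝ) : ℂ)‖ ^ 2
      = (2 * (a ^ 2 + b ^ 2) + 2 * B ^ 2)
        + (2 * (a ^ 2 + b ^ 2) - 2 * B ^ 2) * cos ((2 * (i.val : ℝ) + 1 - n) * x)
        - 4 * a * B * sin ((2 * (i.val : ℝ) + 1 - n) * x) := by
    intro i
    rw [norm_sq_ofReal_combination]
    set t := (2 * (i.val : ℝ) + 1 - n) * (x / 2) with ht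
    rw [show ((i.val : ℝ) + 1) * x = (t + n * (x / 2)) + x / 2 by rw [ht]; ring,
      show ((i.val : ℝ) + 1 - 1) * x = (t + n * (x / 2)) - x / 2 by rw [ht]; ring,
      show ((n : ℝ) - ((i.val : ℝ) + 1)) * x = (n * (x / 2) - x / 2) - t by rw [ht]; ring,
      show (2 * (i.val : ℝ) + 1 - n) * x = 2 * t by rw [ht]; ring]
    have e1 : sin (t + n * (x / 2) + x / 2) - sin (t + n * (x / 2) - x / 2)
        = 2 * sin (x / 2) * (cos t * cos (n * (x / 2)) - sin t * sin (n * (x / 2))) := by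
      rw [sin_add (t + n * (x / 2)), sin_sub (t + n * (x / 2)), cos_add]; ring
    have e2 : sin (t + n * (x / 2) - x / 2) + sin (n * (x / 2) - x / 2 - t)
        = 2 * sin (n * (x / 2) - x / 2) * cos t := by
      rw [show t + n * (x / 2) - x / 2 = (n * (x / 2) - x / 2) + t by ring,
        sin_add (n * (x / 2) - x / 2), sin_sub (n * (x / 2) - x / 2) t]
      ring
    rw [e1, e2, cos_two_mul, sin_two_mul]
    have h1 := sin_sq t
    simp only [a, b, hB]
    linear_combination (4 * sin (x / 2) ^ 2 * sin (n * (x / 2)) ^ 2) * h1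
  simp only [e, Finset.sum_add_distrib, Finset.sum_sub_distrib, ← Finset.mul_sum, h0,
    Finset.sum_const, Finset.card_univ, Fintype.card_fin, nsmul_eq_mul, hB]
  ring

theorem norm_sq_firstVec (α : ℂ) (n : ℕ) (hz : sinh (s α n) ≠ 0) :
    ‖firstVec α n‖ ^ 2 =
      2 * ((sinh (s α n / 2) * cosh (n * (s α n / 2))
              + α.re * sinh (n * (s α n / 2) - s α n / 2)) ^ 2
            + (α.im * sinh (n * (s α n / 2) - s α n / 2)) ^ 2)
          * (n + sinh (n * s α n) / sinh (s α n))
        + 2 * sinh (s α n / 2) ^ 2 * sinh (n * (s α n / 2)) ^ 2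
          * (sinh (n * s α n) / sinh (s α n) - n) := by
  rw [EuclideanSpace.norm_sq_eq, ← sum_cosh_symm n hz]
  have h0 := sum_sinh_symm n hz
  simp only [firstVec]
  generalize s α n = x at *
  set a := sinh (x / 2) * cosh (n * (x / 2)) + α.re * sinh (n * (x / 2) - x / 2)
  set b := α.im * sinh (n * (x / 2) - x / 2)
  set B := sinh (x / 2) * sinh (n * (x / 2)) with hB
  have e : ∀ i : Fin n, ‖((sinh (((i.val : ℝ) + 1) * x) : ℝ) : ℂ)
      - (1 - (starRingEnd ℂ) α) * ((sinh (((i.val : ℝ) + 1 - 1) * x) : ℝ) : ℂ)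
      + (starRingEnd ℂ) α * ((sinh (((n : ℝ) - ((i.val : ℝ) + 1)) * x) : ℝ) : ℂ)‖ ^ 2
      = (2 * (a ^ 2 + b ^ 2) - 2 * B ^ 2)
        + (2 * (a ^ 2 + b ^ 2) + 2 * B ^ 2) * cosh ((2 * (i.val : ℝ) + 1 - n) * x)
        + 4 * a * B * sinh ((2 * (i.val : ℝ) + 1 - n) * x) := by
    intro i
    rw [norm_sq_ofReal_combination]
    set t := (2 * (i.val : ℝ) + 1 - n) * (x / 2) with ht
    rw [show ((i.val : ℝ) + 1) * x = (t + n * (x / 2)) + x / 2 by rw [ht]; ring,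
      show ((i.val : ℝ) + 1 - 1) * x = (t + n * (x / 2)) - x / 2 by rw [ht]; ring,
      show ((n : ℝ) - ((i.val : ℝ) + 1)) * x = (n * (x / 2) - x / 2) - t by rw [ht]; ring,
      show (2 * (i.val : ℝ) + 1 - n) * x = 2 * t by rw [ht]; ring]
    have e1 : sinh (t + n * (x / 2) + x / 2) - sinh (t + n * (x / 2) - x / 2)
        = 2 * sinh (x / 2) * (cosh t * cosh (n * (x / 2)) + sinh t * sinh (n * (x / 2))) := by
      rw [sinh_add (t + n * (x / 2)), sinh_sub (t + n * (x / 2)), cosh_add]; ring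
    have e2 : sinh (t + n * (x / 2) - x / 2) + sinh (n * (x / 2) - x / 2 - t)
        = 2 * sinh (n * (x / 2) - x / 2) * cosh t := by
      rw [show t + n * (x / 2) - x / 2 = (n * (x / 2) - x / 2) + t by ring,
        sinh_add (n * (x / 2) - x / 2), sinh_sub (n * (x / 2) - x / 2) t]
      ring
    rw [e1, e2, cosh_two_mul, sinh_two_mul]
    have h1 := cosh_sq t
    simp only [a, b, hB]
    linear_combination (2 * (a ^ 2 + b ^ 2) - 2 * B ^ 2) * h1
  simp only [e, Finset.sum_add_distrib, ← Finset.mul_sum, h0,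
    Finset.sum_const, Finset.card_univ, Fintype.card_fin, nsmul_eq_mul, hB]
  ring

/-- Here sin(nz/2) = 0, which removes the second summand and the correction sin(nz)/sin z. -/
theorem norm_innerVec_of_odd {α : ℂ} (hα : α.re < 0) {n j : ℕ} (hn : N α ≤ n) (hj : 3 ≤ j)
    (hjn : j ≤ n) (ho : Odd j) :
    ‖innerVec α n j‖ = ‖1 - α‖ * √((n : ℝ) / 2 * eigval α n j) := by
  obtain ⟨hz, hlam⟩ := z_of_odd hα hn hj hjn ho
  rw [← hz] at hlam
  have hn0 : (0 : ℝ) < n := by exact_mod_cast (by omega : 0 < n)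
  have hpi := pi_pos
  have hj1 : (3 : ℝ) ≤ j := by exact_mod_cast hj
  have hj2 : (j : ℝ) ≤ n := by exact_mod_cast hjn
  have hz0 : 0 < z α n j := by
    rw [hz]
    have : (0 : ℝ) < j - 1 := by linarith
    positivity
  have hzpi : z α n j < π := by
    rw [hz, div_lt_iff₀ hn0]; nlinarith
  have hs : sin (n * (z α n j / 2)) = 0 := by
    obtain ⟨k, rfl⟩ := ho
    rw [hz]
    push_cast
    rw [show (n : ℝ) * ((2 * (k : ℝ) + 1 - 1) * π / n / 2) = k * π by field_simp; ring]
    exact sin_nat_mul_pi k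
  have hc : cos (n * (z α n j / 2)) ^ 2 = 1 := by rw [cos_sq', hs]; norm_num
  have hS : sin (n * z α n j) = 0 := by
    rw [show n * z α n j = 2 * (n * (z α n j / 2)) by ring, sin_two_mul, hs]; ring
  have h := norm_sq_innerVec α n j (sin_pos_of_pos_of_lt_pi hz0 hzpi).ne'
  rw [sin_sub, hs, hS] at h
  have hnorm : ‖1 - α‖ ^ 2 = (1 - α.re) ^ 2 + α.im ^ 2 := by
    rw [← Complex.normSq_eq_norm_sq, Complex.normSq_apply]
    simp
    ring
  have hg0 : 0 ≤ (n : ℝ) / 2 * eigval α n j := by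
    rw [hlam, g]; positivity
  rw [← sq_eq_sq₀ (norm_nonneg _) (by positivity), mul_pow, sq_sqrt hg0, h, hlam, hnorm, g]
  linear_combination (2 * n * sin (z α n j / 2) ^ 2 * ((1 - α.re) ^ 2 + α.im ^ 2)) * hc

/-! ### Asymptotics for even j. -/

theorem sin_sub_of_kappa {α : ℂ} {m h : ℝ} (hx : sin m * cos h = kappa α * sin h * cos m) :
    sin (m - h) = (kappa α - 1) * (sin h * cos m) := by
  rw [sin_sub, hx]; ring

theorem sinh_sub_of_kappa {α : ℂ} {m h : ℝ} (hx : sinh m * cosh h = kappa α * sinh h * cosh m) :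
    sinh (m - h) = (kappa α - 1) * (sinh h * cosh m) := by
  rw [sinh_sub, hx]; ring

noncomputable def beta (α : ℂ) : ℝ := α.im * (kappa α - 1)

/-- The tangent equation gives cos²(nx/2) = cos²(x/2)/`nuDen` and sin²(nx/2) = ϰ² sin²(x/2)/`nuDen`,
which eliminates n from the amplitudes. -/
noncomputable def nuDen (α : ℂ) (x : ℝ) : ℝ := cos (x / 2) ^ 2 + kappa α ^ 2 * sin (x / 2) ^ 2

/-- The two components of a smooth vector function whose squared norm is `nu α / 2`. -/
noncomputable def nuFst (α : ℂ) (x : ℝ) : ℝ :=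
  sin (x / 2) * (beta α * cos (x / 2)) / √(nuDen α x)

noncomputable def nuSnd (α : ℂ) (x : ℝ) : ℝ :=
  sin (x / 2) * (kappa α * sin (x / 2)) / √(nuDen α x)

noncomputable def sqrtNu (α : ℂ) (x : ℝ) : ℝ := √2 * ‖(⟨nuFst α x, nuSnd α x⟩ : ℂ)‖

theorem one_le_nuDen {α : ℂ} (hα : α.re < 0) (x : ℝ) : 1 ≤ nuDen α x := by
  unfold nuDen
  have h1 := one_lt_kappa hα
  have h2 := sin_sq_add_cos_sq (x / 2)
  have : 1 ≤ kappa α ^ 2 := by nlinarith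
  nlinarith [sq_nonneg (sin (x / 2))]

theorem sqrtNu_nonneg (α : ℂ) (x : ℝ) : 0 ≤ sqrtNu α x := by
  unfold sqrtNu; positivity

theorem sqrtNu_sq (α : ℂ) (x : ℝ) :
    sqrtNu α x ^ 2 = 2 * (nuFst α x ^ 2 + nuSnd α x ^ 2) := by
  unfold sqrtNu
  rw [mul_pow, sq_sqrt (by norm_num), ← Complex.normSq_eq_norm_sq, Complex.normSq_apply]
  ring

theorem nu_eq_sqrtNu_sq {α : ℂ} (hα : α.re < 0) {x : ℝ} (hx0 : 0 < x) (hx : x < π) :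
    nu α x = sqrtNu α x ^ 2 := by
  have hq := one_le_nuDen hα x
  have hq0 : 0 < nuDen α x := by linarith
  have hsq := sq_sqrt hq0.le
  have hsq0 : √(nuDen α x) ≠ 0 := (sqrt_pos.mpr hq0).ne'
  have hc : 0 < cos (x / 2) := cos_pos_of_mem_Ioo ⟨by linarith, by linarith⟩
  have hk := re_mul_kappa hα
  set A := arctan (kappa α * tan (x / 2)) with hA
  have hden : √(1 + (kappa α * tan (x / 2)) ^ 2) = √(nuDen α x) / cos (x / 2) := by
    rw [eq_div_iff hc.ne', ← sqrt_sq hc.le, ← sqrt_mul (by positivity)]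
    congr 1
    unfold nuDen
    rw [tan_eq_sin_div_cos]
    field_simp
  have hcA : cos A = cos (x / 2) / √(nuDen α x) := by
    rw [hA, cos_arctan, hden, one_div_div]
  have hsA : sin A = kappa α * sin (x / 2) / √(nuDen α x) := by
    rw [hA, sin_arctan, hden, tan_eq_sin_div_cos]
    field_simp
  have heta : eta α x = 2 * A - π := by
    unfold eta
    rw [if_neg hx.ne]
  have hg1 : g (eta α x) = 4 * cos A ^ 2 := by
    rw [heta, g, show (2 * A - π) / 2 = A - π / 2 by ring, sin_sub_pi_div_two]; ring
  have hg2 : g (x - eta α x) = 4 * (cos (x / 2) * cos A + sin (x / 2) * sin A) ^ 2 := by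
    rw [heta, g, show (x - (2 * A - π)) / 2 = (x / 2 - A) + π / 2 by ring, sin_add_pi_div_two,
      cos_sub]
  have hnorm : ‖α‖ ^ 2 = α.re ^ 2 + α.im ^ 2 := by
    rw [← Complex.normSq_eq_norm_sq, Complex.normSq_apply]; ring
  rw [sqrtNu_sq, nu, hg1, hg2, hcA, hsA, hnorm, g, nuFst, nuSnd, beta]
  simp only [div_pow, mul_pow, hsq]
  have e : (cos (x / 2) * (cos (x / 2) / √(nuDen α x))
      + sin (x / 2) * (kappa α * sin (x / 2) / √(nuDen α x))) ^ 2
      = (cos (x / 2) ^ 2 + kappa α * sin (x / 2) ^ 2) ^ 2 / nuDen α x := by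
    rw [← hsq, ← div_pow]
    congr 1
    rw [sqrt_sq (sqrt_nonneg _)]
    field_simp
  rw [e]
  field_simp
  have hD : nuDen α x = 1 + (kappa α ^ 2 - 1) * sin (x / 2) ^ 2 := by
    unfold nuDen; rw [cos_sq']; ring
  rw [hD, cos_sq']
  linear_combination (4 * (sin (x / 2) ^ 2 - sin (x / 2) ^ 4)
    * (1 + α.re * (kappa α - 1))) * hk

theorem exists_lipschitz_of_contDiff {f : ℝ → ℝ} (hf : ContDiff ℝ 1 f) (a b : ℝ) :
    ∃ K : ℝ, 0 ≤ K ∧ ∀ x ∈ Set.Icc a b, ∀ y ∈ Set.Icc a b, |f x - f y| ≤ K * |x - y| := by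
  obtain ⟨K, hK⟩ := (hf.locallyLipschitz.locallyLipschitzOn
    (s := Set.Icc a b)).exists_lipschitzOnWith_of_compact isCompact_Icc
  refine ⟨K, K.2, fun x hx y hy => ?_⟩
  have := hK.dist_le_mul x hx y hy
  rwa [Real.dist_eq, Real.dist_eq] at this

/-- The components are smooth because `nuDen` is at least 1, and the norm is 1-Lipschitz. No square
root is differentiated at the zero of ν. -/
theorem exists_lipschitz_sqrtNu {α : ℂ} (hα : α.re < 0) :
    ∃ K : ℝ, 0 ≤ K ∧ ∀ x ∈ Set.Icc 0 π, ∀ y ∈ Set.Icc 0 π,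
      |sqrtNu α x - sqrtNu α y| ≤ K * |x - y| := by
  have hne : ∀ x, nuDen α x ≠ 0 := fun x => by linarith [one_le_nuDen hα x]
  have hden : ContDiff ℝ 1 (fun x => √(nuDen α x)) := by
    refine ContDiff.sqrt ?_ hne
    unfold nuDen
    fun_prop
  have hden0 : ∀ x, √(nuDen α x) ≠ 0 := fun x =>
    (sqrt_pos.mpr (by linarith [one_le_nuDen hα x])).ne'
  have h1 : ContDiff ℝ 1 (nuFst α) := by
    unfold nuFst
    exact ContDiff.div (by fun_prop) hden hden0
  have h2 : ContDiff ℝ 1 (nuSnd α) := by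
    unfold nuSnd
    exact ContDiff.div (by fun_prop) hden hden0
  obtain ⟨K1, hK1, hL1⟩ := exists_lipschitz_of_contDiff h1 0 π
  obtain ⟨K2, hK2, hL2⟩ := exists_lipschitz_of_contDiff h2 0 π
  refine ⟨√2 * (K1 + K2), by positivity, fun x hx y hy => ?_⟩
  unfold sqrtNu
  rw [← mul_sub, abs_mul, abs_of_nonneg (sqrt_nonneg 2), mul_assoc]
  gcongr
  refine (abs_norm_sub_norm_le _ _).trans ((Complex.norm_le_abs_re_add_abs_im _).trans ?_)
  rw [add_mul]
  exact add_le_add (hL1 x hx y hy) (hL2 x hx y hy)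

theorem norm_sq_innerVec_of_even {α : ℂ} (hα : α.re < 0) {n j : ℕ}
    (hs : 0 < sin (z α n j / 2)) (hc : 0 < cos (z α n j / 2))
    (hx : sin (n * (z α n j / 2)) * cos (z α n j / 2)
        = kappa α * sin (z α n j / 2) * cos (n * (z α n j / 2))) :
    ‖innerVec α n j‖ ^ 2
      = 2 * nuFst α (z α n j) ^ 2 * (n + kappa α / nuDen α (z α n j))
        + 2 * nuSnd α (z α n j) ^ 2 * (n - kappa α / nuDen α (z α n j)) := by
  have hsin : sin (z α n j) = 2 * sin (z α n j / 2) * cos (z α n j / 2) := by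
    rw [← sin_two_mul]; ring_nf
  have hsinn : sin (n * z α n j) = 2 * sin (n * (z α n j / 2)) * cos (n * (z α n j / 2)) := by
    rw [← sin_two_mul]; ring_nf
  rw [norm_sq_innerVec α n j (by rw [hsin]; positivity), hsin, hsinn, sin_sub_of_kappa hx]
  generalize z α n j = x at *
  have hq := one_le_nuDen hα x
  have hq0 : nuDen α x ≠ 0 := by linarith
  have hk := re_mul_kappa hα
  have hone := sin_sq_add_cos_sq (n * (x / 2))
  have hC : cos (n * (x / 2)) ^ 2 * nuDen α x = cos (x / 2) ^ 2 := by
    unfold nuDen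
    linear_combination (-(sin (n * (x / 2)) * cos (x / 2)
      + kappa α * sin (x / 2) * cos (n * (x / 2)))) * hx + cos (x / 2) ^ 2 * hone
  have hS : sin (n * (x / 2)) ^ 2 * nuDen α x = kappa α ^ 2 * sin (x / 2) ^ 2 := by
    unfold nuDen
    linear_combination (sin (n * (x / 2)) * cos (x / 2)
      + kappa α * sin (x / 2) * cos (n * (x / 2))) * hx
      + kappa α ^ 2 * sin (x / 2) ^ 2 * hone
  have h1 : nuFst α x ^ 2 = beta α ^ 2 * sin (x / 2) ^ 2 * cos (n * (x / 2)) ^ 2 := by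
    unfold nuFst
    rw [div_pow, sq_sqrt (by linarith), div_eq_iff hq0]
    linear_combination (-(beta α ^ 2 * sin (x / 2) ^ 2)) * hC
  have h2 : nuSnd α x ^ 2 = sin (x / 2) ^ 2 * sin (n * (x / 2)) ^ 2 := by
    unfold nuSnd
    rw [div_pow, sq_sqrt (by linarith), div_eq_iff hq0]
    linear_combination (-(sin (x / 2) ^ 2)) * hS
  have h3 : 2 * sin (n * (x / 2)) * cos (n * (x / 2)) / (2 * sin (x / 2) * cos (x / 2))
      = kappa α / nuDen α x := by
    rw [div_eq_div_iff (by positivity) hq0]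
    apply mul_right_cancel₀ hc.ne'
    linear_combination (2 * cos (n * (x / 2)) * nuDen α x) * hx
      + 2 * kappa α * sin (x / 2) * hC
  rw [h1, h2, h3, beta]
  -- The real cosine amplitude vanishes because 1 + Re(α)(ϰ - 1) = 0.
  have h4 : sin (x / 2) * cos (n * (x / 2))
      + α.re * ((kappa α - 1) * (sin (x / 2) * cos (n * (x / 2)))) = 0 := by
    linear_combination (sin (x / 2) * cos (n * (x / 2))) * hk
  rw [h4]
  ring

/-- Cancelling b from |a - b| b ≤ |a - b|(a + b) ≤ c b gives a bound uniform in b, however small b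
is. -/
theorem abs_sub_le_of_abs_sq_sub_sq_le {a b c : ℝ} (ha : 0 ≤ a) (hb : 0 ≤ b)
    (h : |a ^ 2 - b ^ 2| ≤ c * b) (hb0 : b = 0 → a = 0) (hc : 0 ≤ c) : |a - b| ≤ c := by
  rcases hb.eq_or_lt with h0 | h0
  · rw [hb0 h0.symm, ← h0]; simpa using hc
  · rw [show a ^ 2 - b ^ 2 = (a - b) * (a + b) by ring, abs_mul,
      abs_of_nonneg (add_nonneg ha hb)] at h
    have h1 : |a - b| * b ≤ |a - b| * (a + b) := by
      gcongr
      linarith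
    exact le_of_mul_le_mul_right (h1.trans h) h0

theorem exists_bound_innerVec_of_even {α : ℂ} (hα : α.re < 0) :
    ∃ C : ℝ, 0 < C ∧ ∀ n : ℕ, N α ≤ n → ∀ j : ℕ, 4 ≤ j → j ≤ n → Even j →
      |‖innerVec α n j‖ - √(nu α (d n j) * (n : ℝ))| ≤ C / √(n : ℝ) := by
  obtain ⟨K, hK, hL⟩ := exists_lipschitz_sqrtNu hα
  have hpi := pi_pos
  have hk1 := one_lt_kappa hα
  -- The first term bounds the correction ϰ√ν with √ν ≤ Kπ, the second the move from z to d; the 1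
  -- ensures positivity.
  refine ⟨kappa α * (K * π) + K * π + 1, by positivity, fun n hn j hj hjn he => ?_⟩
  obtain ⟨hzm, hx⟩ := z_of_even hα hn (by omega) hjn he
  have hn0 : (0 : ℝ) < n := by exact_mod_cast (by omega : 0 < n)
  have hj4 : (4 : ℝ) ≤ j := by exact_mod_cast hj
  have hjn' : (j : ℝ) ≤ n := by exact_mod_cast hjn
  have hdπ : d n j < π := by
    unfold d
    rw [div_lt_iff₀ hn0]; nlinarith
  have hzd : z α n j < d n j := hzm.2
  have hz0 : 0 < z α n j := by
    refine lt_trans ?_ hzm.1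
    have : (0 : ℝ) < j - 2 := by linarith
    positivity
  have hdz : d n j - z α n j ≤ π / n := by
    have h1 := hzm.1
    have : d n j = (j - 2) * π / n + π / n := by unfold d; ring
    linarith
  have hs : 0 < sin (z α n j / 2) := sin_pos_of_pos_of_lt_pi (by linarith) (by linarith)
  have hc : 0 < cos (z α n j / 2) := cos_pos_of_mem_Ioo ⟨by linarith, by linarith⟩
  have hnorm := norm_sq_innerVec_of_even hα hs hc hx
  rw [nu_eq_sqrtNu_sq hα (by linarith) hdπ, sqrt_mul (sq_nonneg _), sqrt_sq (sqrtNu_nonneg _ _)]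
  have hq := one_le_nuDen hα (z α n j)
  have hsq := sqrtNu_sq α (z α n j)
  have hR0 := sqrtNu_nonneg α (z α n j)
  have hsn : √(n : ℝ) ^ 2 = n := sq_sqrt hn0.le
  have hsn0 : 0 < √(n : ℝ) := sqrt_pos.mpr hn0
  have hS0 : 0 ≤ kappa α / nuDen α (z α n j) := by positivity
  have hS1 : kappa α / nuDen α (z α n j) ≤ kappa α := div_le_self (by linarith) hq
  have hdiff : |‖innerVec α n j‖ ^ 2 - (sqrtNu α (z α n j) * √(n : ℝ)) ^ 2|
      ≤ kappa α * sqrtNu α (z α n j) ^ 2 := by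
    rw [mul_pow, hsn, hnorm, hsq]
    have h1 := sq_nonneg (nuFst α (z α n j))
    have h2 := sq_nonneg (nuSnd α (z α n j))
    rw [abs_le]
    constructor <;> nlinarith [mul_nonneg h1 hS0, mul_nonneg h2 hS0,
      mul_le_mul_of_nonneg_left hS1 h1, mul_le_mul_of_nonneg_left hS1 h2]
  have hRle : sqrtNu α (z α n j) ≤ K * π := by
    have h1 := hL (z α n j) ⟨hz0.le, by linarith⟩ 0 ⟨le_rfl, hpi.le⟩
    have h2 : sqrtNu α 0 = 0 := by
      have := sqrtNu_sq α 0
      simpa [nuFst, nuSnd] using this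
    rw [h2, sub_zero, sub_zero, abs_of_nonneg hR0, abs_of_pos hz0] at h1
    exact h1.trans (by gcongr; linarith)
  have hA : |‖innerVec α n j‖ - sqrtNu α (z α n j) * √(n : ℝ)|
      ≤ kappa α * sqrtNu α (z α n j) / √(n : ℝ) := by
    apply abs_sub_le_of_abs_sq_sub_sq_le (norm_nonneg _) (by positivity) _ _ (by positivity)
    · refine hdiff.trans_eq ?_
      field_simp
    · intro h
      have h0 : sqrtNu α (z α n j) = 0 := (mul_eq_zero.mp h).resolve_right hsn0.ne'
      rw [h0] at hdiff
      simpa using hdiff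
  have hB : |sqrtNu α (z α n j) * √(n : ℝ) - sqrtNu α (d n j) * √(n : ℝ)|
      ≤ K * π / √(n : ℝ) := by
    rw [← sub_mul, abs_mul, abs_of_pos hsn0, le_div_iff₀ hsn0, mul_assoc, ← sq, hsn]
    have h1 := hL (z α n j) ⟨hz0.le, by linarith⟩ (d n j) ⟨by linarith, hdπ.le⟩
    have h2 : |z α n j - d n j| ≤ π / n := by
      rw [abs_sub_comm, abs_of_pos (by linarith)]; exact hdz
    calc _ ≤ K * (π / n) * n := by
          gcongr
          exact h1.trans (by gcongr)
      _ = K * π := by field_simp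
  calc _ ≤ _ := abs_sub_le _ (sqrtNu α (z α n j) * √(n : ℝ)) _
    _ ≤ kappa α * sqrtNu α (z α n j) / √(n : ℝ) + K * π / √(n : ℝ) := add_le_add hA hB
    _ = (kappa α * sqrtNu α (z α n j) + K * π) / √(n : ℝ) := by ring
    _ ≤ _ := by
      refine div_le_div_of_nonneg_right ?_ hsn0.le
      have := mul_le_mul_of_nonneg_left hRle (by linarith : 0 ≤ kappa α)
      linarith

/-! ### Asymptotics of the first eigenvector. -/

theorem norm_sq_firstVec_of_root {α : ℂ} (hα : α.re < 0) {n : ℕ} (hs0 : 0 < s α n)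
    (hx : sinh (n * (s α n / 2)) * cosh (s α n / 2)
        = kappa α * sinh (s α n / 2) * cosh (n * (s α n / 2))) :
    ‖firstVec α n‖ ^ 2
      = 2 / kappa α * (cosh (n * (s α n / 2)) ^ 2 - 1)
          * ((beta α ^ 2 + 1) * cosh (n * (s α n / 2)) ^ 2 - 1)
        + 2 * n * sinh (s α n / 2) ^ 2 * ((beta α ^ 2 - 1) * cosh (n * (s α n / 2)) ^ 2 + 1) := by
  have hs : 0 < sinh (s α n / 2) := sinh_pos_iff.mpr (by linarith)
  have hc := cosh_pos (s α n / 2)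
  have hsin : sinh (s α n) = 2 * sinh (s α n / 2) * cosh (s α n / 2) := by
    rw [← sinh_two_mul]; ring_nf
  have hsinn : sinh (n * s α n) = 2 * sinh (n * (s α n / 2)) * cosh (n * (s α n / 2)) := by
    rw [← sinh_two_mul]; ring_nf
  rw [norm_sq_firstVec α n (by rw [hsin]; positivity), hsin, hsinn, sinh_sub_of_kappa hx]
  generalize s α n = x at *
  have hk := re_mul_kappa hα
  have hk1 := one_lt_kappa hα
  have hk0 : kappa α ≠ 0 := by linarith
  have hSq : sinh (n * (x / 2)) ^ 2 = cosh (n * (x / 2)) ^ 2 - 1 := sinh_sq _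
  -- The eigenvalue equation absorbs the quotient sinh(nx)/sinh x, leaving a polynomial in
  -- cosh²(nx/2).
  have h3 : sinh (x / 2) ^ 2 *
      (2 * sinh (n * (x / 2)) * cosh (n * (x / 2)) / (2 * sinh (x / 2) * cosh (x / 2)))
      = (cosh (n * (x / 2)) ^ 2 - 1) / kappa α := by
    rw [← hSq, ← mul_div_assoc, div_eq_div_iff (by positivity) hk0]
    linear_combination (-(2 * sinh (x / 2) * sinh (n * (x / 2)))) * hx
  have h4 : sinh (x / 2) * cosh (n * (x / 2))
      + α.re * ((kappa α - 1) * (sinh (x / 2) * cosh (n * (x / 2)))) = 0 := by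
    linear_combination (sinh (x / 2) * cosh (n * (x / 2))) * hk
  rw [h4]
  set S := 2 * sinh (n * (x / 2)) * cosh (n * (x / 2)) / (2 * sinh (x / 2) * cosh (x / 2))
  rw [beta]
  linear_combination (2 * (α.im * (kappa α - 1)) ^ 2 * cosh (n * (x / 2)) ^ 2
    + 2 * sinh (n * (x / 2)) ^ 2) * h3
    + (2 * ((cosh (n * (x / 2)) ^ 2 - 1) / kappa α) - 2 * sinh (x / 2) ^ 2 * n) * hSq

/-- The hyperbolic equation in exponential form, using e^ω = 1 - 2 Re α. It shows that e^ω - e^x is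
of order e^(-nx). -/
theorem exp_mul_sub_exp {α : ℂ} (hα : α.re < 0) {n : ℕ} {x : ℝ}
    (hx : sinh (n * (x / 2)) * cosh (x / 2) = kappa α * sinh (x / 2) * cosh (n * (x / 2))) :
    exp (n * x) * (exp (omega α) - exp x) = exp (omega α) * exp x - 1 := by
  have hk := re_mul_kappa hα
  rw [exp_omega hα]
  have e1 : exp x = exp (x / 2) * exp (x / 2) := by rw [← exp_add]; ring_nf
  have e2 : exp (n * x) = exp (n * (x / 2)) * exp (n * (x / 2)) := by rw [← exp_add]; ring_nf
  simp only [sinh_eq, cosh_eq, exp_neg] at hx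
  rw [e1, e2]
  have ha := exp_pos (x / 2)
  have hb := exp_pos (n * (x / 2))
  generalize exp (x / 2) = a at *
  generalize exp (n * (x / 2)) = b at *
  field_simp at hx
  linear_combination (-α.re) * hx - (a ^ 2 - 1) * (b ^ 2 + 1) * hk

/-- The radicand is the leading coefficient of the squared norm in cosh⁴(ns/2); the 1/4 comes from
cosh²(ns/2) ≈ e^(ns)/4. -/
theorem mu_eq {α : ℂ} (hα : α.re < 0) :
    mu α = √(2 * (1 + beta α ^ 2) / kappa α) / 4 := by
  have hk1 := one_lt_kappa hα
  have hnorm : ‖α‖ ^ 2 = α.re ^ 2 + α.im ^ 2 := by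
    rw [← Complex.normSq_eq_norm_sq, Complex.normSq_apply]; ring
  have hpos : 0 < 2 * (α.re ^ 2 - α.re) := by nlinarith [sq_nonneg α.re]
  have hmu : 0 ≤ mu α := by unfold mu; positivity
  rw [← sq_eq_sq₀ hmu (by positivity), div_pow, sq_sqrt (by positivity), mu, div_pow, mul_pow,
    sq_sqrt hpos.le, hnorm, beta, kappa]
  have h1 : α.re ≠ 0 := hα.ne
  have h2 : α.re - 1 ≠ 0 := by linarith
  have h3 : α.re ^ 2 - α.re ≠ 0 := by linarith
  field_simp
  ring

theorem exists_bound_exp {α : ℂ} (hα : α.re < 0) :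
    ∃ C : ℝ, 0 ≤ C ∧ ∀ n : ℕ, N α ≤ n →
      |exp (n * s α n) - exp (n * omega α)| ≤ C * n := by
  obtain ⟨s₀, hs₀, hs⟩ := exists_lower_bound_s hα
  -- With t = n(ω - s), the difference is e^(ns)(e^t - 1) ≤ e^(ns) t e^t. The first factor comes
  -- from e^(ns) t ≤ n e^(2ω), the second from t ≤ e^(2ω)/s₀.
  refine ⟨exp (2 * omega α) * exp (exp (2 * omega α) / s₀), by positivity, fun n hn => ?_⟩
  obtain ⟨⟨hl, hu⟩, hx⟩ := hs n hn
  have hn3 : 3 ≤ n := (le_max_left _ _).trans hn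
  have hn0 : (0 : ℝ) < n := by exact_mod_cast (by omega : 0 < n)
  have hid := exp_mul_sub_exp hα hx
  set x := s α n
  set t := n * (omega α - x) with ht
  have hx0 : 0 < x := by linarith
  have h1 : omega α - x ≤ exp (omega α) - exp x := by
    have h2 : exp (omega α) = exp x * exp (omega α - x) := by rw [← exp_add]; ring_nf
    have h3 := add_one_le_exp (omega α - x)
    have h4 := one_le_exp hx0.le
    rw [h2]
    nlinarith
  have h2 : exp (n * x) * (omega α - x) ≤ exp (2 * omega α) := by
    calc _ ≤ exp (n * x) * (exp (omega α) - exp x) := by gcongr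
      _ = exp (omega α) * exp x - 1 := hid
      _ ≤ exp (omega α) * exp (omega α) := by
        have : exp (omega α) * exp x ≤ exp (omega α) * exp (omega α) := by gcongr
        linarith
      _ = exp (2 * omega α) := by rw [← exp_add]; ring_nf
  have h3 : exp (n * x) * t ≤ n * exp (2 * omega α) := by
    calc _ = n * (exp (n * x) * (omega α - x)) := by rw [ht]; ring
      _ ≤ _ := by gcongr
  have ht0 : 0 ≤ t := mul_nonneg hn0.le (by linarith)
  -- The bound s ≥ s₀, uniform in n, is needed here: e^(ns) ≥ n s₀ cancels the factor n.
  have h4 : t ≤ exp (2 * omega α) / s₀ := by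
    rw [le_div_iff₀ hs₀]
    have h5 : n * s₀ ≤ exp (n * x) := by
      have := add_one_le_exp (n * x)
      nlinarith
    have h6 : n * (t * s₀) ≤ n * exp (2 * omega α) := by
      calc _ = (n * s₀) * t := by ring
        _ ≤ exp (n * x) * t := by gcongr
        _ ≤ _ := h3
    exact le_of_mul_le_mul_left h6 hn0
  have h5 : exp (n * omega α) = exp (n * x) * exp t := by rw [← exp_add, ht]; ring_nf
  have h6 : exp t - 1 ≤ t * exp t := by
    have := add_one_le_exp (-t)
    have h7 : exp t * exp (-t) = 1 := by rw [← exp_add]; simp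
    nlinarith [exp_pos t]
  have h7 : 0 ≤ exp t - 1 := by linarith [add_one_le_exp t]
  rw [h5, abs_sub_comm, show exp (n * x) * exp t - exp (n * x) = exp (n * x) * (exp t - 1) by ring,
    abs_of_nonneg (by positivity)]
  calc _ ≤ exp (n * x) * (t * exp t) := by gcongr
    _ = (exp (n * x) * t) * exp t := by ring
    _ ≤ (n * exp (2 * omega α)) * exp (exp (2 * omega α) / s₀) := by gcongr
    _ = _ := by ring

theorem abs_cosh_sq_sub_le {y : ℝ} (hy : 0 ≤ y) : |cosh (y / 2) ^ 2 - exp y / 4| ≤ 1 := by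
  have h1 : cosh (y / 2) ^ 2 = exp y / 4 + 1 / 2 + exp (-y) / 4 := by
    have e1 : exp y = exp (y / 2) * exp (y / 2) := by rw [← exp_add]; ring_nf
    have e2 : exp (-y) = exp (-(y / 2)) * exp (-(y / 2)) := by rw [← exp_add]; ring_nf
    have e3 : exp (y / 2) * exp (-(y / 2)) = 1 := by rw [← exp_add]; simp
    rw [cosh_eq, e1, e2]
    linear_combination e3 / 2
  have h2 : exp (-y) ≤ 1 := exp_le_one_iff.mpr (by linarith)
  have h3 := exp_pos (-y)
  rw [h1, abs_le]
  constructor <;> linarith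

theorem exists_bound_firstVec {α : ℂ} (hα : α.re < 0) :
    ∃ C : ℝ, 0 < C ∧ ∀ n : ℕ, N α ≤ n →
      |‖firstVec α n‖ - mu α * exp ((n : ℝ) * omega α)| ≤ C * n := by
  obtain ⟨s₀, hs₀, hs⟩ := exists_lower_bound_s hα
  obtain ⟨K, hK0, hK⟩ := exists_bound_exp hα
  have hk1 := one_lt_kappa hα
  set M := √(2 * (1 + beta α ^ 2) / kappa α) with hM
  have hM0 : 0 < M := sqrt_pos.mpr (by positivity)
  have hM2 : M ^ 2 = 2 * (1 + beta α ^ 2) / kappa α := sq_sqrt (by positivity)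
  set K1 := 2 / kappa α * (beta α ^ 2 + 3)
    + 2 * sinh (omega α / 2) ^ 2 * (beta α ^ 2 + 2) with hK1
  have hK10 : 0 < K1 := by positivity
  -- The three terms account for the lower-order part of the squared norm, for cosh²(ns/2) against
  -- e^(ns)/4, and for s against ω.
  refine ⟨K1 / M + M + M * K / 4, by positivity, fun n hn => ?_⟩
  obtain ⟨⟨hl, hu⟩, hx⟩ := hs n hn
  have hn3 : 3 ≤ n := (le_max_left _ _).trans hn
  have hn1 : (1 : ℝ) ≤ n := by exact_mod_cast (by omega : 1 ≤ n)
  have hx0 : 0 < s α n := by linarith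
  have hnorm := norm_sq_firstVec_of_root hα hx0 hx
  set X := cosh (n * (s α n / 2)) ^ 2 with hX
  have hX1 : 1 ≤ X := by
    have := one_le_cosh (n * (s α n / 2))
    rw [hX]; nlinarith
  have hsig : sinh (s α n / 2) ^ 2 ≤ sinh (omega α / 2) ^ 2 := by
    have h1 : sinh (s α n / 2) ≤ sinh (omega α / 2) := sinh_le_sinh.mpr (by linarith)
    have h2 : 0 ≤ sinh (s α n / 2) := sinh_nonneg_iff.mpr (by linarith)
    gcongr
  have hA : |‖firstVec α n‖ - M * X| ≤ K1 * n / M := by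
    apply abs_sub_le_of_abs_sq_sub_sq_le (norm_nonneg _) (by positivity) _ _ (by positivity)
    · have e : ‖firstVec α n‖ ^ 2 - (M * X) ^ 2 = 2 / kappa α * (1 - (beta α ^ 2 + 2) * X)
          + 2 * n * sinh (s α n / 2) ^ 2 * ((beta α ^ 2 - 1) * X + 1) := by
        rw [hnorm, mul_pow, hM2]
        ring
      have b1 : |1 - (beta α ^ 2 + 2) * X| ≤ (beta α ^ 2 + 3) * X := by
        have := sq_nonneg (beta α)
        rw [abs_le]; constructor <;> nlinarith
      have b2 : |(beta α ^ 2 - 1) * X + 1| ≤ (beta α ^ 2 + 2) * X := by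
        have := sq_nonneg (beta α)
        rw [abs_le]; constructor <;> nlinarith
      rw [e]
      refine (abs_add_le _ _).trans ?_
      rw [abs_mul, abs_mul, abs_of_pos (by positivity : 0 < 2 / kappa α),
        abs_of_nonneg (by positivity : 0 ≤ 2 * n * sinh (s α n / 2) ^ 2)]
      calc _ ≤ 2 / kappa α * ((beta α ^ 2 + 3) * X)
            + 2 * n * sinh (omega α / 2) ^ 2 * ((beta α ^ 2 + 2) * X) := by gcongr
        _ ≤ 2 / kappa α * ((beta α ^ 2 + 3) * X) * n
            + 2 * n * sinh (omega α / 2) ^ 2 * ((beta α ^ 2 + 2) * X) := by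
          exact add_le_add_left (le_mul_of_one_le_right (by positivity) hn1) _
        _ = K1 * n / M * (M * X) := by
          rw [hK1]
          field_simp
    · intro h
      exact absurd h (by positivity)
  have hB : |M * X - M * (exp (n * s α n) / 4)| ≤ M := by
    rw [← mul_sub, abs_mul, abs_of_pos hM0]
    have := abs_cosh_sq_sub_le (y := n * s α n) (by positivity)
    rw [show n * s α n / 2 = n * (s α n / 2) by ring] at this
    calc _ ≤ M * 1 := by gcongr
      _ = M := mul_one M
  have hC : |M * (exp (n * s α n) / 4) - M / 4 * exp (n * omega α)| ≤ M * K / 4 * n := by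
    rw [show M * (exp (n * s α n) / 4) - M / 4 * exp (n * omega α)
      = M / 4 * (exp (n * s α n) - exp (n * omega α)) by ring, abs_mul,
      abs_of_pos (by positivity : 0 < M / 4)]
    calc _ ≤ M / 4 * (K * n) := by gcongr; exact hK n hn
      _ = _ := by ring
  rw [mu_eq hα, ← hM]
  have h1 := abs_sub_le ‖firstVec α n‖ (M * X) (M / 4 * exp (n * omega α))
  have h2 := abs_sub_le (M * X) (M * (exp (n * s α n) / 4)) (M / 4 * exp (n * omega α))
  have h3 : M ≤ M * n := le_mul_of_one_le_right hM0.le hn1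
  have h4 : K1 * n / M = K1 / M * n := by ring
  linarith

end WeightedCycle

theorem mainTheorem7 (α : ℂ) (hα : α.re < 0) :
    (∀ n : ℕ, WeightedCycle.N α ≤ n → ∀ j : ℕ, 3 ≤ j → j ≤ n → Odd j →
      ‖WeightedCycle.innerVec α n j‖
        = ‖1 - α‖ * Real.sqrt ((n : ℝ) / 2 * WeightedCycle.eigval α n j)) ∧
    (∃ C : ℝ, 0 < C ∧
      ∀ n : ℕ, WeightedCycle.N α ≤ n → ∀ j : ℕ, 4 ≤ j → j ≤ n → Even j →
        |‖WeightedCycle.innerVec α n j‖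
            - Real.sqrt (WeightedCycle.nu α (WeightedCycle.d n j) * (n : ℝ))|
          ≤ C / Real.sqrt (n : ℝ)) ∧
    (∃ C : ℝ, 0 < C ∧
      ∀ n : ℕ, WeightedCycle.N α ≤ n →
        |‖WeightedCycle.firstVec α n‖
            - WeightedCycle.mu α * Real.exp ((n : ℝ) * WeightedCycle.omega α)| ≤ C * (n : ℝ) ∧
        |‖WeightedCycle.firstVec α n‖
            - WeightedCycle.mu α * (1 - 2 * α.re) ^ n| ≤ C * (n : ℝ)) := by
  refine ⟨fun n hn j hj hjn ho => WeightedCycle.norm_innerVec_of_odd hα hn hj hjn ho,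
    WeightedCycle.exists_bound_innerVec_of_even hα, ?_⟩
  obtain ⟨C, hC, h⟩ := WeightedCycle.exists_bound_firstVec hα
  refine ⟨C, hC, fun n hn => ⟨h n hn, ?_⟩⟩
  rw [← WeightedCycle.exp_omega hα, ← Real.exp_nat_mul]
  exact h n hn
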